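/- Let $n,m\ge 0$ and $0\le k\le n$ be integers. For a partition $\lambda=(\lambda_1\ge\cdots\ge\lambda_n\ge 0)$ with at most $n$ parts let $s_\lambda$ be the Schur polynomial (with $s_\lambda(w_1,\dots,w_m)=0$ if $\lambda$ has more than $m$ nonzero parts), and let $$G(u)=\sum_{\lambda}s_\lambda(y_1,\dots,y_n)\,s_\lambda(w_1,\dots,w_m)\prod_{i=1}^n(\lambda_i+(n-i)+u),$$ the sum running over all partitions with at most $n$ parts, regarded as a formal power series in the $y_i$ and $w_j$ whose coefficients are polynomials in $u$. Put $u=-x$ and expand the coefficients, which are polynomials in $x$, in the basis of falling factorials $(x)_r=x(x-1)\cdots(x-r+1)$, $r\ge 0$. Then the coefficient of $(x)_{n-k}$ in $G(-x)$ is $(-1)^{n-k}E_k$, where $$E_k=\prod_{i=1}^n\prod_{j=1}^m(1-y_iw_j)^{-1}\sum_{\substack{1\le j_1<\cdots<j_k\le n\\ i_1,\dots,i_k\in\{1,\dots,m\}\text{ pairwise distinct}}}\ \prod_{r=1}^k\frac{y_{j_r}w_{i_r}}{1-y_{j_r}w_{i_r}}.$$ (Equivalently, $E_k$ is the coefficient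 of the rising factorial $u(u+1)\cdots(u+n-k-1)=(-1)^{n-k}(x)_{n-k}$ in $G(u)$.) Moreover, if $m\ge n$, then the coefficient of the monomial $w_1w_2\cdots w_n$ in $E_k$, as a power series in $y_1,\dots,y_n$, is $$(n)_k\,(y_1+\cdots+y_n)^{n-k}\,e_k(y_1,\dots,y_n),$$ where $(n)_k=n(n-1)\cdots(n-k+1)$ and $e_k$ is the $k$-th elementary symmetric polynomial. -/

import Mathlib

/-- A partition with at most `n` parts, written `λ₁ ≥ λ₂ ≥ ⋯ ≥ λₙ ≥ 0` with trailing zeros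
(and indexed from `0`). -/
abbrev BoundedPartition (n : ℕ) : Type := {μ : Fin n → ℕ // Antitone μ}

/-- The `i`-th part of a partition (indexed from `0`), which is `0` beyond the listed parts. -/
def BoundedPartition.get {n : ℕ} (μ : BoundedPartition n) (i : ℕ) : ℕ := if h : i < n then μ.1 ⟨i, h⟩ else 0

/-- The Vandermonde product `a_δ = ∏_{i < j} (x_i - x_j)` in `m` variables. -/
noncomputable def vandermondeProd (m : ℕ) : MvPolynomial (Fin m) ℚ :=
  ∏ i : Fin m, ∏ j ∈ Finset.Ioi i, (MvPolynomial.X i - MvPolynomial.X j)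

/-- The alternant `a_α = det (x_i ^ α_j)` in `m` variables. -/
noncomputable def alternant {m : ℕ} (α : Fin m → ℕ) : MvPolynomial (Fin m) ℚ :=
  Matrix.det (Matrix.of fun i j : Fin m => (MvPolynomial.X i : MvPolynomial (Fin m) ℚ) ^ α j)

/-- The exponents `λ + δ`, where `δ = (m - 1, m - 2, …, 0)`. -/
def BoundedPartition.addDelta {n : ℕ} (μ : BoundedPartition n) (m : ℕ) (j : Fin m) : ℕ := μ.get j + (m - 1 - j)

theorem alternant_delta (m : ℕ) :
    alternant (fun j : Fin m => m - 1 - (j : ℕ)) = vandermondeProd m := by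
  have h := Matrix.det_projVandermonde (R := MvPolynomial (Fin m) ℚ) (fun _ => 1)
    (fun i => MvPolynomial.X i)
  simp only [one_mul] at h
  rw [vandermondeProd, ← h, alternant]
  congr 1
  ext1 i j
  rw [Matrix.projVandermonde_apply, Matrix.of_apply, one_pow, one_mul]
  congr 1
  simp [Fin.val_rev]
  omega

theorem vandermondeProd_dvd_alternant {m : ℕ} (α : Fin m → ℕ) :
    vandermondeProd m ∣ alternant α := by
  classical
  let P : Polynomial (MvPolynomial (Fin m) ℚ) :=
    ∏ l : Fin m, (Polynomial.X - Polynomial.C (MvPolynomial.X l))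
  have hP : P.Monic := Polynomial.monic_prod_of_monic _ _ fun l _ => Polynomial.monic_X_sub_C (MvPolynomial.X l)
  have hdeg : P.natDegree = m := by
    rw [Polynomial.natDegree_prod_of_monic _ _
      (fun l _ => Polynomial.monic_X_sub_C (MvPolynomial.X l : MvPolynomial (Fin m) ℚ))]
    simp
  let r : ℕ → Polynomial (MvPolynomial (Fin m) ℚ) := fun a => (Polynomial.X ^ a) %ₘ P
  have hr : ∀ a, (r a).degree < (m : ℕ) := fun a => by
    have := Polynomial.degree_modByMonic_lt (Polynomial.X ^ a) hP
    rwa [Polynomial.degree_eq_natDegree hP.ne_zero, hdeg] at this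
  have hev : ∀ (i : Fin m) (a : ℕ), (MvPolynomial.X i : MvPolynomial (Fin m) ℚ) ^ a =
      ∑ j : Fin m, MvPolynomial.X i ^ (m - 1 - (j : ℕ)) * (r a).coeff (m - 1 - (j : ℕ)) := by
    intro i a
    have h0 : P.eval (MvPolynomial.X i) = 0 := by
      rw [Polynomial.eval_prod]
      exact Finset.prod_eq_zero (Finset.mem_univ i) (by simp)
    have h1 : (r a).eval (MvPolynomial.X i) = (MvPolynomial.X i : MvPolynomial (Fin m) ℚ) ^ a := by
      have := congrArg (Polynomial.eval (MvPolynomial.X i))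
        (Polynomial.modByMonic_add_div (Polynomial.X ^ a) P)
      simpa [h0, r] using this
    have hm : 0 < m := i.pos
    rw [← h1, Polynomial.eval_eq_sum_range' (n := m)
      (by
        by_cases h : r a = 0
        · simpa [h] using hm
        · exact (Polynomial.natDegree_lt_iff_degree_lt h).2 (hr a)), Finset.sum_range,
      ← Equiv.sum_comp Fin.revPerm]
    refine Finset.sum_congr rfl fun j _ => ?_
    have : ((Fin.revPerm j : Fin m) : ℕ) = m - 1 - j := by simp [Fin.val_rev]; omega
    rw [this, mul_comm]
  refine ⟨Matrix.det (Matrix.of fun j k : Fin m => (r (α k)).coeff (m - 1 - (j : ℕ))), ?_⟩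
  rw [← alternant_delta, alternant, alternant, ← Matrix.det_mul]
  congr 1
  ext1 i k
  simp only [Matrix.mul_apply, Matrix.of_apply]
  exact hev i (α k)

/-- The Schur polynomial `s_λ(x_1, …, x_m) = a_{λ+δ} / a_δ`, which is `0` when `λ` has more than
`m` nonzero parts. The quotient is unique because `a_δ ≠ 0`. -/
noncomputable def schur {n : ℕ} (m : ℕ) (μ : BoundedPartition n) : MvPolynomial (Fin m) ℚ :=
  open Classical in
  if ∀ i, m ≤ i → μ.get i = 0 then
    Classical.choose (vandermondeProd_dvd_alternant (μ.addDelta m))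
  else 0

theorem vandermondeProd_mul_schur {n m : ℕ} (μ : BoundedPartition n) (h : ∀ i, m ≤ i → μ.get i = 0) :
    vandermondeProd m * schur m μ = alternant (μ.addDelta m) := by
  rw [schur, if_pos h]
  exact (Classical.choose_spec (vandermondeProd_dvd_alternant (μ.addDelta m))).symm

theorem vandermondeProd_ne_zero (m : ℕ) : vandermondeProd m ≠ 0 := by
  refine Finset.prod_ne_zero_iff.2 fun i _ => Finset.prod_ne_zero_iff.2 fun j hj => ?_
  exact sub_ne_zero.2 fun h => (Finset.mem_Ioi.1 hj).ne (MvPolynomial.X_injective h)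

theorem alternant_isHomogeneous {m : ℕ} (α : Fin m → ℕ) :
    (alternant α).IsHomogeneous (∑ j, α j) := by
  rw [alternant, Matrix.det_apply']
  refine MvPolynomial.IsHomogeneous.sum _ _ _ fun σ _ => ?_
  have h : (∏ j, (Matrix.of fun i j : Fin m =>
      (MvPolynomial.X i : MvPolynomial (Fin m) ℚ) ^ α j) (σ j) j).IsHomogeneous (∑ j, α j) :=
    MvPolynomial.IsHomogeneous.prod _ _ _ fun j _ => by
      simpa using (MvPolynomial.isHomogeneous_X ℚ (σ j)).pow (α j)
  have h1 : (((Equiv.Perm.sign σ : ℤ) : MvPolynomial (Fin m) ℚ)).IsHomogeneous 0 := by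
    rw [← map_intCast (MvPolynomial.C (σ := Fin m) (R := ℚ))]
    exact MvPolynomial.isHomogeneous_C _ _
  simpa using h1.mul h

/-- `s_λ(x_1, …, x_n)` is homogeneous of degree `|λ|`. -/
theorem schur_isHomogeneous {n : ℕ} (μ : BoundedPartition n) :
    (schur n μ).IsHomogeneous (∑ i, μ.1 i) := by
  classical
  have h0 : ∀ i, n ≤ i → μ.get i = 0 := fun i hi => by simp [BoundedPartition.get, not_lt.2 hi]
  have hmul := vandermondeProd_mul_schur μ h0
  have hget : ∀ j : Fin n, μ.get j = μ.1 j := fun j => by simp [BoundedPartition.get]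
  have ha := alternant_isHomogeneous (μ.addDelta n)
  have hd := alternant_isHomogeneous (fun j : Fin n => n - 1 - (j : ℕ))
  rw [alternant_delta] at hd
  simp only [BoundedPartition.addDelta, hget, Finset.sum_add_distrib] at ha
  set N := ∑ j : Fin n, (n - 1 - (j : ℕ))
  set s := schur n μ
  have key : ∀ k, k ≠ ∑ i, μ.1 i → MvPolynomial.homogeneousComponent k s = 0 := by
    intro k hk
    have hs := MvPolynomial.sum_homogeneousComponent s
    have h2 := congrArg (MvPolynomial.homogeneousComponent (k + N)) hmul
    rw [MvPolynomial.homogeneousComponent_of_mem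
      ((MvPolynomial.mem_homogeneousSubmodule _ _).2 ha), if_neg (by omega), ← hs,
      Finset.mul_sum, map_sum] at h2
    have h3 : ∀ i, MvPolynomial.homogeneousComponent (k + N)
        (vandermondeProd n * MvPolynomial.homogeneousComponent i s) =
        if i = k then vandermondeProd n * MvPolynomial.homogeneousComponent i s else 0 := by
      intro i
      rw [MvPolynomial.homogeneousComponent_of_mem ((MvPolynomial.mem_homogeneousSubmodule _ _).2
        (hd.mul (MvPolynomial.homogeneousComponent_isHomogeneous i s)))]
      exact if_congr (by omega) rfl rfl
    simp only [h3, Finset.sum_ite_eq', Finset.mem_range] at h2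
    by_cases hlt : k < s.totalDegree + 1
    · rw [if_pos hlt] at h2
      exact (mul_eq_zero.1 h2).resolve_left (vandermondeProd_ne_zero n)
    · exact MvPolynomial.homogeneousComponent_eq_zero _ _ (by omega)
  rw [← MvPolynomial.sum_homogeneousComponent s]
  refine MvPolynomial.IsHomogeneous.sum _ _ _ fun k _ => ?_
  by_cases hk : k = ∑ i, μ.1 i
  · exact hk ▸ MvPolynomial.homogeneousComponent_isHomogeneous k s
  · rw [key k hk]
    exact MvPolynomial.isHomogeneous_zero _ _ _

/-- The product `s_λ(y_1, …, y_n) s_λ(w_1, …, w_m)`. The variable `y_i` is indexed by `Sum.inl i`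
and `w_j` by `Sum.inr j`. -/
noncomputable def schurProduct {n : ℕ} (m : ℕ) (μ : BoundedPartition n) : MvPolynomial (Fin n ⊕ Fin m) ℚ :=
  MvPolynomial.rename Sum.inl (schur n μ) * MvPolynomial.rename Sum.inr (schur m μ)

/-- Only finitely many partitions contribute to a given monomial. -/
theorem schurProduct_coeff_finite {n m : ℕ} (d : Fin n ⊕ Fin m →₀ ℕ) :
    {μ : BoundedPartition n | (schurProduct m μ).coeff d ≠ 0}.Finite := by
  classical
  have hfin : {ν : Fin n → ℕ | ∀ i, ν i ≤ d.degree}.Finite := by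
    have := Set.Finite.pi' (fun _ : Fin n => Set.finite_Iic d.degree)
    simpa using this
  refine Set.Finite.subset (hfin.preimage Subtype.val_injective.injOn) fun μ hμ => ?_
  rw [Set.mem_ofPred_eq, schurProduct, MvPolynomial.coeff_mul] at hμ
  obtain ⟨p, hp, hne⟩ := Finset.exists_ne_zero_of_sum_ne_zero hμ
  have h1 := (MvPolynomial.IsHomogeneous.rename_isHomogeneous (f := (Sum.inl : _ → Fin n ⊕ Fin m))
    (schur_isHomogeneous μ)) (left_ne_zero_of_mul hne)
  have h2 : p.1.degree = ∑ i, μ.1 i := by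
    rw [← h1, Finsupp.degree_eq_weight_one]; rfl
  have h3 : p.1.degree + p.2.degree = d.degree := by
    rw [← map_add, Finset.HasAntidiagonal.mem_antidiagonal.1 hp]
  intro i
  have := Finset.single_le_sum (f := μ.1) (fun _ _ => Nat.zero_le _) (Finset.mem_univ i)
  change μ.1 i ≤ _
  omega

/-- The Andrews–Goulden–Jackson sum
`G(u) = ∑_λ s_λ(y_1, …, y_n) s_λ(w_1, …, w_m) ∏_{i=1}^n (λ_i + (n - i) + u)`
over the partitions with at most `n` parts, as a formal power series in the `y` and `w` with
coefficients in `ℚ[x]`; here `u` is any element of `ℚ[x]`. The sum is taken coefficientwise, each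
coefficient being a finite sum. -/
noncomputable def agjSum (n m : ℕ) (u : Polynomial ℚ) :
    MvPowerSeries (Fin n ⊕ Fin m) (Polynomial ℚ) := fun d =>
  ∑ᶠ μ : BoundedPartition n, (schurProduct m μ).coeff d •
    ∏ i : Fin n, (((μ.1 i + (n - 1 - (i : ℕ)) : ℕ) : Polynomial ℚ) + u)

/-- The falling factorials `(x)_j = x (x - 1) ⋯ (x - j + 1)` as a sequence of polynomials with
one in each degree. -/
noncomputable def fallingSequence : Polynomial.Sequence ℚ where
  elems' j := descPochhammer ℚ j
  degree_eq' j := by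
    rw [Polynomial.degree_eq_natDegree (monic_descPochhammer ℚ j).ne_zero,
      descPochhammer_natDegree]

/-- The falling factorials as a basis of `ℚ[x]`. -/
noncomputable def fallingBasis : Module.Basis ℕ ℚ (Polynomial ℚ) :=
  fallingSequence.basis fun j => by
    have h : (fallingSequence j : Polynomial ℚ).leadingCoeff = 1 := monic_descPochhammer ℚ j
    rw [h]
    exact isUnit_one

theorem fallingBasis_apply (j : ℕ) : fallingBasis j = descPochhammer ℚ j :=
  Polynomial.Sequence.basis_eq_self _ _ j

/-- The coefficient of `(x)_j` in a power series whose coefficients are polynomials in `x`, when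
these are expanded in falling factorials. -/
noncomputable def fallingCoeff {σ : Type*} (j : ℕ) (F : MvPowerSeries σ (Polynomial ℚ)) :
    MvPowerSeries σ ℚ := fun d => fallingBasis.repr (MvPowerSeries.coeff d F) j

/-- The monomial `y_i w_j` as a power series. -/
noncomputable def yw {n m : ℕ} (i : Fin n) (j : Fin m) : MvPowerSeries (Fin n ⊕ Fin m) ℚ :=
  MvPowerSeries.X (Sum.inl i) * MvPowerSeries.X (Sum.inr j)

/-- The Cauchy kernel `∏_{i=1}^n ∏_{j=1}^m (1 - y_i w_j)⁻¹`. -/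
noncomputable def cauchyKernel (n m : ℕ) : MvPowerSeries (Fin n ⊕ Fin m) ℚ :=
  ∏ i : Fin n, ∏ j : Fin m, (1 - yw i j)⁻¹

/-- The Cauchy kernel times
`∑_{j_1 < ⋯ < j_k} ∑_{i_1, …, i_k distinct} ∏_{r=1}^k y_{j_r} w_{i_r} / (1 - y_{j_r} w_{i_r})`,
with all `j_r` in `{1, …, n}` and all `i_r` in `{1, …, m}`. -/
noncomputable def kernelSum (n m k : ℕ) : MvPowerSeries (Fin n ⊕ Fin m) ℚ :=
  cauchyKernel n m *
    ∑ j : Fin k ↪o Fin n, ∑ i : Fin k ↪ Fin m, ∏ r : Fin k, (yw (j r) (i r) * (1 - yw (j r) (i r))⁻¹)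

/-- The coefficient of the monomial `w^e` in a power series in the `y` and `w`, which is a power
series in the `y`. -/
noncomputable def wCoeff {n m : ℕ} (e : Fin m →₀ ℕ) (F : MvPowerSeries (Fin n ⊕ Fin m) ℚ) :
    MvPowerSeries (Fin n) ℚ := fun d => MvPowerSeries.coeff (Finsupp.sumElim d e) F

/-! Multiply the sum by the Vandermonde product in the `y`. Then `s_λ(y)` turns into an alternant,
while `s_λ(w)` is a Jacobi–Trudi determinant (`schur_eq_jacobiTrudi`). Both are antisymmetric in the
exponents `λ + δ`, so the sum over partitions unfolds into a sum over all exponent vectors, namely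
`det ((θ_i + u) (y_i^(n-j) H(y_i)))` with `θ_i = y_i ∂/∂y_i` and `H(y) = ∏_j (1 - y w_j)⁻¹`
(`vandermonde_mul_agjEval`). With `t_ij = y_i w_j / (1 - y_i w_j)` one has `θ_i H(y_i) = H(y_i) ∑_j
t_ij`. Hence `H(y_i)` leaves row `i`, and the Cauchy kernel appears in front of `det ((n - j + u +
∑_l t_il) y_i^(n-j))`.

The heart is `shiftedVdet_eq`: this determinant is the Vandermonde determinant times `∑_k
u(u+1)⋯(u+n-k-1) M_k`, where `M_k` sums the products of the `t_ij` over `k`-matchings of the grid.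
The induction is on the number of `w`. One more `w` adds, for each `i`, a multiple of `t_i` times
the determinant without `y_i` (`shiftedVdet_succ_add`), which is the recursion of `M_k` by its first
column (`matchSum_succ`). Cancelling the Vandermonde factor and putting `u = -x` gives the falling
factorial expansion.

For the coefficient of `w_1 ⋯ w_n`, all `w_j²` may be set to `0` (`quotient_kernelSum`). The kernel
becomes `∏_j (1 + (∑ y_i) w_j)` and the matching sum becomes `e_k(y)` times a sum over injections;
`k` of the `w` are taken by an injection and the other `n - k` each contribute `∑ y_i`. -/

/-! ### Sums over embeddings and matchings of a grid -/

/-- Insert the value `i` at position `r` into an embedding whose values are made to avoid `i`. -/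
def insertEmb {k n : ℕ} (r : Fin (k + 1)) (i : Fin (n + 1)) (j : Fin k ↪ Fin n) :
    Fin (k + 1) ↪ Fin (n + 1) where
  toFun := r.insertNth (α := fun _ => Fin (n + 1)) i fun s => i.succAbove (j s)
  inj' := by
    intro a b
    refine r.succAboveCases ?_ (fun a' => ?_) a <;> refine r.succAboveCases ?_ (fun b' => ?_) b
    · simp
    · simp [(Fin.succAbove_ne _ _).symm]
    · simp [Fin.succAbove_ne]
    · simp

@[simp] theorem insertEmb_same {k n : ℕ} (r : Fin (k + 1)) (i : Fin (n + 1)) (j : Fin k ↪ Fin n) :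
    insertEmb r i j r = i := by
  change r.insertNth (α := fun _ => Fin (n + 1)) i (fun s => i.succAbove (j s)) r = i
  simp

@[simp] theorem insertEmb_succAbove {k n : ℕ} (r : Fin (k + 1)) (i : Fin (n + 1))
    (j : Fin k ↪ Fin n) (s : Fin k) : insertEmb r i j (r.succAbove s) = i.succAbove (j s) := by
  change r.insertNth (α := fun _ => Fin (n + 1)) i (fun s => i.succAbove (j s)) _ = _
  simp

theorem insertEmb_right_injective {k n : ℕ} (r : Fin (k + 1)) (i : Fin (n + 1)) :
    Function.Injective (insertEmb (n := n) r i) := by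
  intro j j' h
  ext1 s
  have := DFunLike.congr_fun h (r.succAbove s)
  simpa using this

theorem sum_emb_insert {M : Type*} [AddCommMonoid M] {k n : ℕ} (r : Fin (k + 1))
    (F : (Fin (k + 1) ↪ Fin (n + 1)) → M) :
    ∑ j, F j = ∑ i : Fin (n + 1), ∑ j : Fin k ↪ Fin n, F (insertEmb r i j) := by
  rw [← Fintype.sum_prod_type' (f := fun i j => F (insertEmb r i j))]
  symm
  refine Fintype.sum_bijective (fun p : Fin (n + 1) × (Fin k ↪ Fin n) => insertEmb r p.1 p.2)
    ((Fintype.bijective_iff_injective_and_card _).2 ⟨?_, ?_⟩) _ _ fun _ => rfl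
  · rintro ⟨i, j⟩ ⟨i', j'⟩ h
    have h1 : i = i' := by simpa using DFunLike.congr_fun h r
    subst h1
    exact congrArg _ (insertEmb_right_injective r i h)
  · rw [Fintype.card_prod, Fintype.card_embedding_eq, Fintype.card_embedding_eq]
    simp only [Fintype.card_fin, Nat.succ_descFactorial_succ]

theorem succ_descFactorial_succ_eq_add (m k : ℕ) :
    (m + 1).descFactorial (k + 1) = m.descFactorial (k + 1) + (k + 1) * m.descFactorial k := by
  rw [Nat.succ_descFactorial_succ, Nat.descFactorial_succ, ← add_mul]
  rcases le_or_gt k m with h | h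
  · congr 1
    omega
  · simp [Nat.descFactorial_of_lt h]

/-- The value `0` is either missed or taken at exactly one position `r`. Injectivity of this
decomposition and a count of both sides replace an explicit inverse. -/
theorem sum_emb_succ {M : Type*} [AddCommMonoid M] {k m : ℕ}
    (F : (Fin (k + 1) ↪ Fin (m + 1)) → M) :
    ∑ b, F b = ∑ b : Fin (k + 1) ↪ Fin m, F (b.trans (Fin.succEmb m)) +
      ∑ r : Fin (k + 1), ∑ b : Fin k ↪ Fin m, F (insertEmb r 0 b) := by
  rw [← Fintype.sum_prod_type' (f := fun r b => F (insertEmb r 0 b))]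
  let g : (Fin (k + 1) ↪ Fin m) ⊕ (Fin (k + 1) × (Fin k ↪ Fin m)) → (Fin (k + 1) ↪ Fin (m + 1)) :=
    Sum.elim (fun b => b.trans (Fin.succEmb m)) fun p => insertEmb p.1 0 p.2
  have hg : Function.Bijective g := by
    refine (Fintype.bijective_iff_injective_and_card _).2 ⟨?_, ?_⟩
    · have key : ∀ (b : Fin (k + 1) ↪ Fin m) (r : Fin (k + 1)) (b' : Fin k ↪ Fin m),
          b.trans (Fin.succEmb m) ≠ insertEmb r 0 b' := by
        intro b r b' h
        have := DFunLike.congr_fun h r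
        simp at this
      rintro (b | ⟨r, b⟩) (b' | ⟨r', b'⟩) h
      · congr 1
        ext1 s
        have := DFunLike.congr_fun h s
        simpa [g] using this
      · exact (key _ _ _ h).elim
      · exact (key _ _ _ h.symm).elim
      · have h1 : r = r' := by
          apply (insertEmb r 0 b).injective
          rw [insertEmb_same]
          have : insertEmb r 0 b = insertEmb r' 0 b' := h
          rw [this, insertEmb_same]
        subst h1
        exact congrArg _ (congrArg _ (insertEmb_right_injective r 0 h))
    · rw [Fintype.card_sum, Fintype.card_prod, Fintype.card_embedding_eq,
        Fintype.card_embedding_eq, Fintype.card_embedding_eq]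
      simp only [Fintype.card_fin, succ_descFactorial_succ_eq_add]
  rw [← hg.sum_comp, Fintype.sum_sum_type]
  rfl

open scoped Nat in
/-- The sum over the `k`-matchings of an `n × m` grid of the products of the weights `t`. -/
noncomputable def matchSum {R : Type*} [CommRing R] [Algebra ℚ R] {n m : ℕ} (k : ℕ)
    (t : Fin n → Fin m → R) : R :=
  ((k ! : ℕ) : ℚ)⁻¹ • ∑ j : Fin k ↪ Fin n, ∑ i : Fin k ↪ Fin m, ∏ r, t (j r) (i r)

theorem matchSum_zero {R : Type*} [CommRing R] [Algebra ℚ R] {n m : ℕ} (t : Fin n → Fin m → R) :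
    matchSum 0 t = 1 := by
  simp [matchSum]

theorem matchSum_succ_no_cols {R : Type*} [CommRing R] [Algebra ℚ R] {n : ℕ} (k : ℕ)
    (t : Fin n → Fin 0 → R) : matchSum (k + 1) t = 0 := by
  have : IsEmpty (Fin (k + 1) ↪ Fin 0) := ⟨fun f => (f 0).elim0⟩
  simp [matchSum]

/-- Column `0` is either unused or matched with a row `i`. The `k + 1` positions at which an
embedding may take the value `0` contribute equally, and `(k + 1) / (k + 1)! = 1 / k!`. -/
theorem matchSum_succ {R : Type*} [CommRing R] [Algebra ℚ R] {n m k : ℕ}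
    (t : Fin (n + 1) → Fin (m + 1) → R) :
    matchSum (k + 1) t = matchSum (k + 1) (fun i j => t i j.succ) +
      ∑ i, t i 0 * matchSum k fun i' (j : Fin m) => t (i.succAbove i') j.succ := by
  have h : ∀ r : Fin (k + 1),
      ∑ j : Fin (k + 1) ↪ Fin (n + 1), ∑ b : Fin k ↪ Fin m, ∏ s, t (j s) (insertEmb r 0 b s) =
      ∑ i, t i 0 * ∑ j : Fin k ↪ Fin n, ∑ b : Fin k ↪ Fin m,
        ∏ s, t (i.succAbove (j s)) (b s).succ := by
    intro r
    rw [sum_emb_insert r]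
    refine Finset.sum_congr rfl fun i _ => ?_
    simp_rw [Finset.mul_sum]
    refine Finset.sum_congr rfl fun j _ => Finset.sum_congr rfl fun b _ => ?_
    rw [Fin.prod_univ_succAbove _ r]
    simp
  have hf : (((k + 1).factorial : ℕ) : ℚ)⁻¹ * (k + 1 : ℚ) = ((k.factorial : ℕ) : ℚ)⁻¹ := by
    rw [Nat.factorial_succ]
    have : (k.factorial : ℚ) ≠ 0 := by positivity
    push_cast
    field_simp
  simp only [matchSum, sum_emb_succ (m := m), Finset.sum_add_distrib, smul_add]
  congr 1
  rw [Finset.sum_comm, Finset.sum_congr rfl fun r _ => h r, Finset.sum_const, Finset.card_univ,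
    Fintype.card_fin, ← Nat.cast_smul_eq_nsmul ℚ, smul_smul]
  push_cast
  rw [hf, Finset.smul_sum]
  exact Finset.sum_congr rfl fun i _ => (mul_smul_comm _ _ _).symm

/-- Every embedding of `Fin k` is an increasing one after a unique permutation. -/
theorem sum_emb_eq_sum_orderEmb {M : Type*} [AddCommMonoid M] {k n : ℕ}
    (F : (Fin k ↪ Fin n) → M) :
    ∑ j, F j = ∑ σ : Equiv.Perm (Fin k), ∑ j : Fin k ↪o Fin n, F (σ.toEmbedding.trans j.toEmbedding) := by
  rw [← Fintype.sum_prod_type' (f := fun (σ : Equiv.Perm (Fin k)) (j : Fin k ↪o Fin n) =>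
    F (σ.toEmbedding.trans j.toEmbedding))]
  symm
  refine Fintype.sum_bijective (fun p : Equiv.Perm (Fin k) × (Fin k ↪o Fin n) =>
    p.1.toEmbedding.trans p.2.toEmbedding) ⟨?_, ?_⟩ _ _ fun _ => rfl
  · rintro ⟨σ, j⟩ ⟨σ', j'⟩ h
    have h' : ∀ s, j (σ s) = j' (σ' s) := fun s => DFunLike.congr_fun h s
    have h1 : j = j' := by
      rw [← OrderEmbedding.range_inj, ← σ.surjective.range_comp j, ← σ'.surjective.range_comp j']
      exact congrArg Set.range (funext h')
    subst h1
    have h2 : σ = σ' := Equiv.ext fun s => j.injective (h' s)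
    rw [h2]
  · intro f
    have hm : StrictMono (f ∘ Tuple.sort f) :=
      (Tuple.monotone_sort f).strictMono_of_injective (f.injective.comp (Tuple.sort f).injective)
    refine ⟨((Tuple.sort f).symm, OrderEmbedding.ofStrictMono _ hm), ?_⟩
    ext1 s
    simp

/-- Permuting the row indices is absorbed by permuting the column indices, so each increasing choice
of rows is counted `k!` times. -/
theorem matchSum_eq {R : Type*} [CommRing R] [Algebra ℚ R] {n m : ℕ} (k : ℕ)
    (t : Fin n → Fin m → R) :
    matchSum k t = ∑ j : Fin k ↪o Fin n, ∑ i : Fin k ↪ Fin m, ∏ r, t (j r) (i r) := by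
  have hk : (k.factorial : ℚ) ≠ 0 := by positivity
  rw [matchSum, sum_emb_eq_sum_orderEmb, inv_smul_eq_iff₀ hk]
  have h : ∀ σ : Equiv.Perm (Fin k), ∀ j : Fin k ↪o Fin n,
      ∑ i : Fin k ↪ Fin m, ∏ r, t (σ.toEmbedding.trans j.toEmbedding r) (i r) =
        ∑ i : Fin k ↪ Fin m, ∏ r, t (j r) (i r) := by
    intro σ j
    refine Fintype.sum_equiv (σ.embeddingCongr (Equiv.refl _)) _ _ fun i => ?_
    rw [← Equiv.prod_comp σ fun r => t (j r) (σ.embeddingCongr (Equiv.refl _) i r)]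
    refine Finset.prod_congr rfl fun r _ => ?_
    simp
  simp only [h, Finset.sum_const, Finset.card_univ, Fintype.card_perm, Fintype.card_fin]
  rw [← Nat.cast_smul_eq_nsmul ℚ]

/-! ### Vandermonde determinants with shifted weights -/

-- Formally, the right side vanishes at `X = 1 / w`, hence is divisible by `1 - w X`. As `w` need
-- not be invertible, the quotient is built by induction on the number of `y`.
open Polynomial in
theorem exists_monic_mul_one_sub {R : Type*} [CommRing R] [Nontrivial R] (w : R) (n : ℕ) (y : Fin (n + 1) → R) :
    ∃ q : R[X], q.Monic ∧ q.natDegree = n ∧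
      q * (1 - C w * X) = C (∏ i, (1 - w * y i)) * X ^ n - C w * ∏ i, (X - C (y i)) := by
  induction n with
  | zero =>
    refine ⟨1, monic_one, by simp, ?_⟩
    simp
    ring
  | succ n ih =>
    obtain ⟨q, hq, hd, he⟩ := ih fun i => y i.succ
    have hm : ((X - C (y 0)) * q).Monic := (monic_X_sub_C _).mul hq
    have hn : ((X - C (y 0)) * q).natDegree = n + 1 := by
      rw [(monic_X_sub_C _).natDegree_mul hq, hd, natDegree_X_sub_C, add_comm]
    have hlt : (C (y 0 * ∏ i : Fin (n + 1), (1 - w * y i.succ)) * X ^ n).degree <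
        ((X - C (y 0)) * q).degree := by
      rw [degree_eq_natDegree hm.ne_zero, hn]
      exact (degree_C_mul_X_pow_le _ _).trans_lt (by exact_mod_cast n.lt_succ_self)
    refine ⟨(X - C (y 0)) * q + C (y 0 * ∏ i : Fin (n + 1), (1 - w * y i.succ)) * X ^ n,
      hm.add_of_left hlt, ?_, ?_⟩
    · rw [natDegree_add_eq_left_of_degree_lt hlt, hn]
    · rw [Fin.prod_univ_succ (fun i => 1 - w * y i), Fin.prod_univ_succ (fun i => X - C (y i)), add_mul, mul_assoc, he]
      simp only [C_mul, C_sub, C_1]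
      ring

theorem eval_eq_sum_of_monic {R : Type*} [CommRing R] {q : Polynomial R} {n : ℕ} (hq : q.Monic)
    (hd : q.natDegree = n) (f : ℕ → R) :
    q.sum (fun e a => a * f e) =
      f n + ∑ j : Fin n, q.coeff (n - 1 - j) * f (n - 1 - j) := by
  rw [Polynomial.sum_over_range _ (by simp), hd, Finset.sum_range_succ, add_comm]
  congr 1
  · rw [← hd, hq.coeff_natDegree, one_mul]
  · rw [← Finset.sum_range_reflect, Finset.sum_range]

/-- Replacing the column of the highest exponent by a monic combination of all columns. -/
theorem det_updateCol_monic {R : Type*} [CommRing R] {n : ℕ} {q : Polynomial R} (hq : q.Monic)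
    (hd : q.natDegree = n) (f : Fin (n + 1) → ℕ → R) :
    ((Matrix.of fun i j : Fin (n + 1) => f i (n - j)).updateCol 0
      fun i => q.sum fun e a => a * f i e).det = (Matrix.of fun i j : Fin (n + 1) => f i (n - j)).det := by
  have h := Matrix.det_updateCol_sum (Matrix.of fun i j : Fin (n + 1) => f i (n - j)) 0
    fun j => q.coeff (n - j)
  have h0 : q.coeff n = 1 := by rw [← hd, hq.coeff_natDegree]
  simp only [Fin.val_zero, Nat.sub_zero, h0, one_smul] at h
  rw [← h]
  congr 2
  funext i
  rw [eval_eq_sum_of_monic hq hd, Fin.sum_univ_succ]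
  simp [h0]
  refine Finset.sum_congr rfl fun j _ => ?_
  rw [show n - 1 - (j : ℕ) = n - (j + 1) by omega]

/-- The Vandermonde determinant with exponents in decreasing order. -/
noncomputable def vdet {R : Type*} [CommRing R] {n : ℕ} (y : Fin n → R) : R :=
  (Matrix.of fun i j : Fin n => y i ^ (n - 1 - (j : ℕ))).det

/-- The column of highest powers may be replaced by the values of the monic polynomial `∏_{l ≠ i} (X
- y_l)`, which vanish in every row but `i`. -/
theorem vdet_succ {R : Type*} [CommRing R] [Nontrivial R] {n : ℕ} (y : Fin (n + 1) → R) (i : Fin (n + 1)) :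
    vdet y = (-1) ^ (i : ℕ) * (∏ l : Fin n, (y i - y (i.succAbove l))) *
      vdet fun l => y (i.succAbove l) := by
  let q : Polynomial R := ∏ l : Fin n, (Polynomial.X - Polynomial.C (y (i.succAbove l)))
  have hq : q.Monic := Polynomial.monic_prod_of_monic _ _ fun l _ => Polynomial.monic_X_sub_C _
  have hd : q.natDegree = n := by
    rw [Polynomial.natDegree_prod_of_monic _ _ fun l _ => Polynomial.monic_X_sub_C _]
    simp
  have h := det_updateCol_monic hq hd fun l e => y l ^ e
  rw [vdet]
  simp only [Nat.add_sub_cancel]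
  rw [← h, Matrix.det_succ_column_zero, Finset.sum_eq_single i]
  · rw [vdet]
    congr 2
    · rw [Matrix.updateCol_self, ← Polynomial.eval_eq_sum, Polynomial.eval_prod]
      simp
    · ext a b
      simp [Matrix.updateCol_ne]
      congr 1
      omega
  · intro l _ hl
    rw [Matrix.updateCol_self, ← Polynomial.eval_eq_sum, Polynomial.eval_prod]
    obtain ⟨b, rfl⟩ := Fin.exists_succAbove_eq hl
    rw [Finset.prod_eq_zero (Finset.mem_univ b) (by simp)]
    simp
  · simp

/-- The determinant `det ((e_j + c_i) y_i ^ e_j)` with exponents `e_j = n - 1, …, 0`. -/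
noncomputable def shiftedVdet {R : Type*} [CommRing R] {n : ℕ} (y c : Fin n → R) : R :=
  (Matrix.of fun i j : Fin n => (((n - 1 - (j : ℕ) : ℕ) : R) + c i) * y i ^ (n - 1 - (j : ℕ))).det

-- Subtracting `w` times the preceding column removes `t_i` from all columns but the first, at the
-- price of a factor `1 - w y_i` in row `i`. The first column, multiplied by all these factors, is a
-- monic combination of the original columns plus `t_i ∏_{l ≠ i} (y_i - y_l)`; the first summand
-- gives back the old determinant and the second is expanded along the column.
open Polynomial in
theorem shiftedVdet_succ_add {R : Type*} [CommRing R] [Nontrivial R] {n : ℕ} (y c t z : Fin (n + 1) → R) (w : R)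
    (hz : ∀ i, z i * (1 - w * y i) = 1) (ht : ∀ i, t i = w * y i * z i) :
    shiftedVdet y (fun i => c i + t i) = shiftedVdet y c +
      ∑ i, t i * ((-1) ^ (i : ℕ) * (∏ l : Fin n, (y i - y (i.succAbove l)))) *
        shiftedVdet (fun l => y (i.succAbove l)) fun l => c (i.succAbove l) := by
  obtain ⟨q, hq, hd, he⟩ := exists_monic_mul_one_sub w n y
  set κ := ∏ i, (1 - w * y i) with hκ
  let f : Fin (n + 1) → ℕ → R := fun i e => ((e : R) + c i) * y i ^ e
  let L : Matrix (Fin (n + 1)) (Fin (n + 1)) R := Matrix.of fun i j => f i (n - j)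
  let D : Fin (n + 1) → R := fun i => ∏ l : Fin n, (y i - y (i.succAbove l))
  -- The column operation rests on `w y_i = t_i (1 - w y_i)`, which cancels the `t_i` term.
  have hLt : shiftedVdet y (fun i => c i + t i) =
      (Matrix.of fun i j => (1 - w * y i) *
        (L.updateCol 0 fun i => ((n : R) + c i + t i) * y i ^ n * z i) i j).det := by
    refine Matrix.det_eq_of_forall_col_eq_smul_add_pred (fun _ => w) ?_ ?_
    · intro i
      simp only [Matrix.of_apply, Matrix.updateCol_self]
      simp
      linear_combination (-(n + c i + t i) * y i ^ n) * hz i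
    · intro i j
      obtain ⟨e, he⟩ : ∃ e, n - (j : ℕ) = e + 1 := ⟨n - j - 1, by omega⟩
      have he' : n - ((j : ℕ) + 1) = e := by omega
      simp only [Matrix.of_apply, Matrix.updateCol_ne (Fin.succ_ne_zero j), L, f, Fin.val_succ,
        Fin.val_castSucc, Nat.add_sub_cancel, he, he', pow_succ]
      push_cast
      rw [ht]
      linear_combination (w * y i ^ (e + 1)) * hz i
  -- The combination with coefficients of `q` takes the value `y_i q'(y_i) + c_i q(y_i)`. Both terms
  -- come from evaluating the defining identity of `q`, and its derivative, at the root `y_i` of `∏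
  -- (X - y_l)`.
  have hcol : (fun i => q.sum fun e a => a * f i e) + (fun i => t i * D i) =
      κ • fun i => ((n : R) + c i + t i) * y i ^ n * z i := by
    funext i
    have h1 : q.sum (fun e a => a * f i e) = y i * q.derivative.eval (y i) + c i * q.eval (y i) := by
      rw [derivative_eval, eval_eq_sum, Polynomial.sum, Polynomial.sum, Polynomial.sum, Finset.mul_sum,
        Finset.mul_sum, ← Finset.sum_add_distrib]
      refine Finset.sum_congr rfl fun e _ => ?_
      rcases e with _ | e
      · simp [f]; ring
      · simp [f, pow_succ]; ring
    have hχ : (∏ l, (X - C (y l))).eval (y i) = 0 := by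
      rw [eval_prod]
      exact Finset.prod_eq_zero (Finset.mem_univ i) (by simp)
    have hχ' : (derivative (∏ l, (X - C (y l)))).eval (y i) = D i := by
      rw [Fin.prod_univ_succAbove _ i]
      simp [derivative_mul, eval_prod, D]
    have h2 := congrArg (eval (y i)) he
    have h3 := congrArg (fun p => eval (y i) (derivative p)) he
    simp only [derivative_mul, derivative_sub, eval_add, eval_sub, eval_mul, hχ, hχ', derivative_C,
      derivative_one, derivative_X, derivative_X_pow, eval_C, eval_X, eval_one, eval_pow, eval_zero] at h2 h3
    have h4 : (n : R) * y i ^ (n - 1) * y i = n * y i ^ n := by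
      rcases n with _ | n
      · simp
      · simp [pow_succ]; ring
    have h5 : q.eval (y i) = κ * y i ^ n * z i := by
      linear_combination z i * h2 - q.eval (y i) * hz i
    have h6 : y i * q.derivative.eval (y i) = ((n : R) + t i) * κ * y i ^ n * z i - t i * D i := by
      have h7 : y i * q.derivative.eval (y i) * (1 - w * y i) =
          w * y i * q.eval (y i) + κ * (n * y i ^ n) - w * y i * D i := by
        rw [← h4]
        simp at h3
        linear_combination y i * h3
      rw [h5] at h7
      linear_combination z i * h7 - y i * q.derivative.eval (y i) * hz i - (κ * y i ^ n * z i - D i) * ht i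
    simp only [Pi.add_apply, Pi.smul_apply, smul_eq_mul]
    rw [h1, h6, h5]
    ring
  have hL : shiftedVdet y c = L.det := by
    simp only [shiftedVdet, L, f, Nat.add_sub_cancel]
  rw [hLt, Matrix.det_mul_column, ← hκ, ← Matrix.det_updateCol_smul, ← hcol,
    Matrix.det_updateCol_add, det_updateCol_monic hq hd f, ← hL, Matrix.det_succ_column_zero]
  congr 1
  refine Finset.sum_congr rfl fun i _ => ?_
  rw [Matrix.updateCol_self]
  have : ((L.updateCol 0 fun i => t i * D i).submatrix i.succAbove Fin.succ).det =
      shiftedVdet (fun l => y (i.succAbove l)) fun l => c (i.succAbove l) := by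
    rw [shiftedVdet]
    congr 1
    ext a b
    have : n - ((b : ℕ) + 1) = n - 1 - b := by omega
    simp [L, f, Matrix.updateCol_ne, this]
  rw [this]
  ring

theorem shiftedVdet_const {R : Type*} [CommRing R] {n : ℕ} (y : Fin n → R) (u : R) :
    shiftedVdet y (fun _ => u) = vdet y * (ascPochhammer R n).eval u := by
  have h := Matrix.det_mul_row (fun j : Fin n => (((n - 1 - (j : ℕ) : ℕ) : R) + u))
    (Matrix.of fun i j : Fin n => y i ^ (n - 1 - (j : ℕ)))
  simp only [Matrix.of_apply] at h
  rw [shiftedVdet, h, vdet, mul_comm]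
  clear h
  congr 1
  rw [Finset.prod_range (fun j => (((n - 1 - j : ℕ) : R) + u)) |>.symm,
    Finset.prod_range_reflect (fun j => ((j : R) + u))]
  induction n with
  | zero => simp
  | succ n ih =>
    rw [Finset.prod_range_succ, ih fun i => y i.castSucc, ascPochhammer_succ_eval]
    ring

/-- The determinants without `y_i` are covered by the induction hypothesis because `n` is
generalized; `vdet_succ` then restores the full Vandermonde factor, and `matchSum_succ` collects the
terms. -/
theorem shiftedVdet_eq {R : Type*} [CommRing R] [Nontrivial R] [Algebra ℚ R] (u : R) {n m : ℕ} (y : Fin n → R)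
    (w : Fin m → R) (z : Fin n → Fin m → R) (hz : ∀ i j, z i j * (1 - y i * w j) = 1) :
    shiftedVdet y (fun i => u + ∑ j, y i * w j * z i j) =
      vdet y * ∑ k ∈ Finset.range (n + 1), (ascPochhammer R (n - k)).eval u *
        matchSum k fun i j => y i * w j * z i j := by
  induction m generalizing n with
  | zero =>
    rw [Finset.sum_range_succ']
    simp [matchSum_succ_no_cols, matchSum_zero, shiftedVdet_const]
  | succ m ih =>
    rcases n with _ | n
    · simp [shiftedVdet, vdet, matchSum_zero]
    have hfun : (fun i => u + ∑ j, y i * w j * z i j) = fun i =>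
        (u + ∑ j : Fin m, y i * w j.succ * z i j.succ) + y i * w 0 * z i 0 := by
      funext i
      rw [Fin.sum_univ_succ]
      ring
    rw [hfun, shiftedVdet_succ_add y _ _ (fun i => z i 0) (w 0)
      (fun i => by rw [mul_comm (w 0)]; exact hz i 0) (fun i => by ring),
      ih y (fun j => w j.succ) (fun i j => z i j.succ) fun i j => hz i j.succ]
    have h : ∀ i : Fin (n + 1), y i * w 0 * z i 0 *
        ((-1) ^ (i : ℕ) * (∏ l : Fin n, (y i - y (i.succAbove l)))) *
        shiftedVdet (fun l => y (i.succAbove l)) (fun l => u + ∑ j : Fin m, y (i.succAbove l) *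
          w j.succ * z (i.succAbove l) j.succ) = vdet y * ∑ k ∈ Finset.range (n + 1),
        (ascPochhammer R (n - k)).eval u * (y i * w 0 * z i 0 * matchSum k fun l (j : Fin m) =>
          y (i.succAbove l) * w j.succ * z (i.succAbove l) j.succ) := by
      intro i
      rw [ih (fun l => y (i.succAbove l)) (fun j => w j.succ) (fun l j => z (i.succAbove l) j.succ)
        fun l j => hz _ j.succ, vdet_succ y i, Finset.mul_sum, Finset.mul_sum, Finset.mul_sum]
      exact Finset.sum_congr rfl fun k _ => by ring
    -- The matchings using column `0` have size `k + 1`, so the `k = 0` term is split off from both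
    -- full sums before comparing.
    rw [Finset.sum_congr rfl fun i _ => h i, ← Finset.mul_sum, ← mul_add, Finset.sum_comm,
      Finset.sum_range_succ', Finset.sum_range_succ' _ (n + 1), add_right_comm,
      ← Finset.sum_add_distrib]
    congr 2
    · refine Finset.sum_congr rfl fun k _ => ?_
      rw [matchSum_succ, mul_add, Finset.mul_sum, Nat.add_sub_add_right]

/-! ### Schur polynomials as Jacobi–Trudi determinants -/

/-- The geometric series `1 / (1 - a X)`. -/
noncomputable def geomSeries {R : Type*} [CommRing R] (a : R) : PowerSeries R :=
  PowerSeries.mk fun r => a ^ r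

theorem geomSeries_mul {R : Type*} [CommRing R] (a : R) :
    geomSeries a * (1 - PowerSeries.C a * PowerSeries.X) = 1 := by
  rw [mul_sub, mul_one, mul_left_comm]
  ext r
  rcases r with _ | r
  · simp [geomSeries]
  · rw [map_sub, ← mul_assoc, PowerSeries.coeff_succ_mul_X]
    simp [geomSeries, PowerSeries.coeff_one, pow_succ']

/-- The generating function of the complete homogeneous symmetric polynomials. -/
noncomputable def completeSeries (m : ℕ) : PowerSeries (MvPolynomial (Fin m) ℚ) :=
  ∏ j, geomSeries (MvPolynomial.X j)

/-- The Jacobi–Trudi determinant `det (h_{α_i - (n - j)})`. -/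
noncomputable def jacobiTrudi (m : ℕ) {n : ℕ} (α : Fin n → ℕ) : MvPolynomial (Fin m) ℚ :=
  (Matrix.of fun i j : Fin n =>
    PowerSeries.coeff (α i) (PowerSeries.X ^ (n - 1 - (j : ℕ)) * completeSeries m)).det

theorem constantCoeff_completeSeries (m : ℕ) :
    PowerSeries.constantCoeff (completeSeries m) = 1 := by
  rw [completeSeries, map_prod]
  refine Finset.prod_eq_one fun j _ => ?_
  rw [← PowerSeries.coeff_zero_eq_constantCoeff_apply, geomSeries, PowerSeries.coeff_mk, pow_zero]

/-- A zero part makes the last exponent `0`, so the last row is `(0, …, 0, 1)`. Expanding along it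
leaves a minor in which all exponents are lowered by one. -/
theorem jacobiTrudi_succ (m : ℕ) {n N : ℕ} (μ : BoundedPartition n) (h : μ.get N = 0) :
    jacobiTrudi m (μ.addDelta (N + 1)) = jacobiTrudi m (μ.addDelta N) := by
  rw [jacobiTrudi, Matrix.det_succ_row _ (Fin.last N), Finset.sum_eq_single (Fin.last N)]
  · have h1 : μ.addDelta (N + 1) (Fin.last N) = 0 := by simp [BoundedPartition.addDelta, h]
    rw [Matrix.of_apply, h1]
    have h2 : (-1 : MvPolynomial (Fin m) ℚ) ^ ((Fin.last N : ℕ) + (Fin.last N : ℕ)) = 1 :=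
      (Even.add_self _).neg_one_pow
    rw [h2]
    simp only [Fin.val_last, Nat.add_sub_cancel, Nat.sub_self, pow_zero, one_mul,
      PowerSeries.coeff_zero_eq_constantCoeff_apply, constantCoeff_completeSeries, jacobiTrudi]
    congr 1
    ext1 i j
    have hi : μ.addDelta (N + 1) i.castSucc = μ.addDelta N i + 1 := by
      simp [BoundedPartition.addDelta]; omega
    have hj : N - (j : ℕ) = (N - 1 - j) + 1 := by omega
    simp only [Matrix.submatrix_apply, Fin.succAbove_last, Matrix.of_apply, hi, Fin.val_castSucc, hj,
      pow_succ']
    rw [mul_assoc, PowerSeries.coeff_succ_X_mul]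
  · intro j _ hj
    have h1 : μ.addDelta (N + 1) (Fin.last N) = 0 := by simp [BoundedPartition.addDelta, h]
    have h2 : N + 1 - 1 - (j : ℕ) ≠ 0 := by
      have : (j : ℕ) ≠ N := fun h => hj (Fin.ext h)
      omega
    rw [Matrix.of_apply, h1, PowerSeries.coeff_zero_eq_constantCoeff_apply, map_mul, map_pow,
      PowerSeries.constantCoeff_X, zero_pow h2]
    simp
  · simp

theorem jacobiTrudi_eq_of_le (m : ℕ) {n N N' : ℕ} (μ : BoundedPartition n) (hN : N ≤ N')
    (h : ∀ i, N ≤ i → μ.get i = 0) :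
    jacobiTrudi m (μ.addDelta N') = jacobiTrudi m (μ.addDelta N) := by
  induction N', hN using Nat.le_induction with
  | base => rfl
  | succ k hk ih => rw [jacobiTrudi_succ m μ (h k hk), ih]

open Polynomial in
theorem completeSeries_mul_poly (m : ℕ) :
    completeSeries m * ((∏ l : Fin m, (1 - C (MvPolynomial.X l) * X) :
      (MvPolynomial (Fin m) ℚ)[X]) : PowerSeries (MvPolynomial (Fin m) ℚ)) = 1 := by
  rw [← Polynomial.coeToPowerSeries.ringHom_apply, map_prod, completeSeries, ← Finset.prod_mul_distrib]
  refine Finset.prod_eq_one fun j _ => ?_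
  simpa using geomSeries_mul (MvPolynomial.X j : MvPolynomial (Fin m) ℚ)

theorem natDegree_prod_one_sub_le {R : Type*} [CommRing R] {ι : Type*} (s : Finset ι) (a : ι → R) :
    (∏ l ∈ s, (1 - Polynomial.C (a l) * Polynomial.X)).natDegree ≤ s.card := by
  refine (Polynomial.natDegree_prod_le _ _).trans ?_
  rw [Finset.card_eq_sum_ones]
  refine Finset.sum_le_sum fun l _ => ?_
  refine (Polynomial.natDegree_sub_le _ _).trans ?_
  simpa using Polynomial.natDegree_C_mul_le (a l) Polynomial.X |>.trans Polynomial.natDegree_X_le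

/-- The coefficients of `F q` become a row of Jacobi–Trudi type times the coefficient vector of `q`.
This serves both for a null vector and for a matrix factorization. -/
theorem coeff_mul_poly {R : Type*} [CommRing R] (F : PowerSeries R) (q : Polynomial R) {N : ℕ}
    (hq : q.natDegree < N) (p : ℕ) :
    PowerSeries.coeff p (F * (q : PowerSeries R)) =
      ∑ k : Fin N, PowerSeries.coeff p (PowerSeries.X ^ (N - 1 - (k : ℕ)) * F) *
        q.coeff (N - 1 - k) := by
  conv_lhs => rw [q.as_sum_range' N hq]
  rw [← Polynomial.coeToPowerSeries.ringHom_apply, map_sum, Finset.mul_sum, map_sum,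
    ← Finset.sum_range_reflect, Finset.sum_range]
  refine Finset.sum_congr rfl fun k _ => ?_
  rw [Polynomial.coeToPowerSeries.ringHom_apply, ← Polynomial.C_mul_X_pow_eq_monomial,
    Polynomial.coe_mul, Polynomial.coe_C, Polynomial.coe_pow, Polynomial.coe_X, mul_comm F, mul_assoc,
    PowerSeries.coeff_C_mul, mul_comm]

/-- A partition with more than `m` parts has vanishing Jacobi–Trudi determinant. -/
theorem jacobiTrudi_eq_zero (m : ℕ) {n N : ℕ} (μ : BoundedPartition n) (hN : m ≤ N)
    (h : μ.get N ≠ 0) : jacobiTrudi m (μ.addDelta (N + 1)) = 0 := by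
  let q : Polynomial (MvPolynomial (Fin m) ℚ) :=
    ∏ l : Fin m, (1 - Polynomial.C (MvPolynomial.X l) * Polynomial.X)
  have hq : q.natDegree < N + 1 := by
    have := natDegree_prod_one_sub_le (Finset.univ : Finset (Fin m))
      fun l => (MvPolynomial.X l : MvPolynomial (Fin m) ℚ)
    rw [Finset.card_univ, Fintype.card_fin] at this
    exact (this.trans hN).trans_lt N.lt_succ_self
  rw [jacobiTrudi, ← Matrix.exists_mulVec_eq_zero_iff]
  -- The coefficients of `q = ∏ (1 - x_l X)` form a null vector: `H q = 1` has no coefficients in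
  -- positive degree, and every row exponent is positive. The vector is nonzero because `q(0) = 1`.
  refine ⟨fun k => q.coeff (N + 1 - 1 - (k : ℕ)), ?_, ?_⟩
  · intro h0
    have := congrFun h0 (Fin.last N)
    simp [q, Polynomial.coeff_zero_eq_eval_zero, Polynomial.eval_prod] at this
  · funext i
    have hi : μ.addDelta (N + 1) i ≠ 0 := by
      have hn : N < n := by
        by_contra hn
        exact h (dif_neg hn)
      have h2 : μ.get N ≤ μ.get i := by
        have hin : (i : ℕ) < n := by omega
        simp only [BoundedPartition.get, hn, hin, dif_pos]
        exact μ.2 (Fin.mk_le_mk.2 (by omega))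
      simp only [BoundedPartition.addDelta]
      omega
    have := coeff_mul_poly (completeSeries m) q hq (μ.addDelta (N + 1) i)
    rw [completeSeries_mul_poly, PowerSeries.coeff_one, if_neg hi] at this
    exact this.symm

/-- Multiplying `H` by `∏_{l ≠ i} (1 - x_l X)` leaves `1 / (1 - x_i X)`, whose coefficients are the
powers of `x_i`. So the alternant matrix is, up to transposition, the Jacobi–Trudi matrix times a
matrix independent of `α`. -/
theorem exists_alternant_eq (m : ℕ) :
    ∃ c : MvPolynomial (Fin m) ℚ, ∀ α : Fin m → ℕ, alternant α = jacobiTrudi m α * c := by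
  classical
  let q : Fin m → Polynomial (MvPolynomial (Fin m) ℚ) := fun i =>
    ∏ l ∈ Finset.univ.erase i, (1 - Polynomial.C (MvPolynomial.X l) * Polynomial.X)
  refine ⟨(Matrix.of fun k i : Fin m => (q i).coeff (m - 1 - (k : ℕ))).det, fun α => ?_⟩
  rw [jacobiTrudi, ← Matrix.det_mul, alternant, ← Matrix.det_transpose]
  congr 1
  ext1 j i
  have hq : (q i).natDegree < m := by
    refine (natDegree_prod_one_sub_le _ _).trans_lt ?_
    rw [Finset.card_erase_of_mem (Finset.mem_univ i), Finset.card_univ, Fintype.card_fin]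
    have := i.pos
    omega
  have hg : completeSeries m * (q i : PowerSeries (MvPolynomial (Fin m) ℚ)) = geomSeries (MvPolynomial.X i) := by
    have h1 := completeSeries_mul_poly m
    rw [← Finset.mul_prod_erase _ _ (Finset.mem_univ i), Polynomial.coe_mul] at h1
    have h2 := geomSeries_mul (MvPolynomial.X i : MvPolynomial (Fin m) ℚ)
    have h3 : ((1 - Polynomial.C (MvPolynomial.X i) * Polynomial.X :
      Polynomial (MvPolynomial (Fin m) ℚ)) : PowerSeries (MvPolynomial (Fin m) ℚ)) =
      1 - PowerSeries.C (MvPolynomial.X i) * PowerSeries.X := by simp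
    rw [h3] at h1
    linear_combination geomSeries (MvPolynomial.X i) * h1 - completeSeries m * (q i : PowerSeries (MvPolynomial (Fin m) ℚ)) * h2
  rw [Matrix.transpose_apply, Matrix.mul_apply, Matrix.of_apply]
  have := coeff_mul_poly (completeSeries m) (q i) hq (α j)
  rw [hg, geomSeries, PowerSeries.coeff_mk] at this
  exact this

theorem schur_eq_jacobiTrudi {n : ℕ} (m : ℕ) (μ : BoundedPartition n) :
    schur m μ = jacobiTrudi m (μ.addDelta n) := by
  have hn : ∀ i, n ≤ i → μ.get i = 0 := fun i hi => by simp [BoundedPartition.get, not_lt.2 hi]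
  by_cases h : ∀ i, m ≤ i → μ.get i = 0
  · have hmn : jacobiTrudi m (μ.addDelta n) = jacobiTrudi m (μ.addDelta m) := by
      rcases le_total n m with hle | hle
      · exact (jacobiTrudi_eq_of_le m μ hle hn).symm
      · exact jacobiTrudi_eq_of_le m μ hle h
    obtain ⟨c, hc⟩ := exists_alternant_eq m
    -- The constant is found from the empty partition, whose Jacobi–Trudi determinant reduces to
    -- size `0`.
    have hv : vandermondeProd m = c := by
      let ν : BoundedPartition n := ⟨fun _ => 0, fun _ _ _ => le_rfl⟩
      have hν : ∀ i, ν.get i = 0 := fun i => by simp [BoundedPartition.get, ν]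
      have h0 : ν.addDelta m = fun j : Fin m => m - 1 - (j : ℕ) := by
        funext j
        simp [BoundedPartition.addDelta, hν]
      have h1 : jacobiTrudi m (ν.addDelta m) = 1 := by
        rw [jacobiTrudi_eq_of_le m ν (Nat.zero_le m) fun i _ => hν i, jacobiTrudi]
        simp
      rw [← alternant_delta, ← h0, hc, h1, one_mul]
    refine mul_left_cancel₀ (vandermondeProd_ne_zero m) ?_
    rw [vandermondeProd_mul_schur μ h, hmn, hc, hv, mul_comm]
  · rw [schur, if_neg h]
    classical
    push Not at h
    obtain ⟨i, hi, h0⟩ := h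
    -- Cutting the determinant down to the number of nonzero parts makes its last part nonzero, as
    -- `jacobiTrudi_eq_zero` requires.
    have hex : ∃ N, ∀ i, N ≤ i → μ.get i = 0 := ⟨n, hn⟩
    have hf := Nat.find_spec hex
    have hlt : i < Nat.find hex := by
      by_contra hlt
      exact h0 (hf i (not_lt.1 hlt))
    have hle : Nat.find hex ≤ n := Nat.find_min' hex hn
    rw [jacobiTrudi_eq_of_le m μ hle hf]
    obtain ⟨N, hN⟩ : ∃ N, Nat.find hex = N + 1 := ⟨Nat.find hex - 1, by omega⟩
    rw [hN] at hf hlt ⊢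
    refine (jacobiTrudi_eq_zero m μ (by omega) fun h1 => ?_).symm
    refine Nat.find_min hex (m := N) (by omega) fun i hi => ?_
    rcases hi.eq_or_lt with rfl | hi
    · exact h1
    · exact hf i hi

/-! ### Substituting the `y` into one-variable series -/

/-- The product `∏ i, p_i(y_i)` as a power series in the `y` and `w`, for power series `p_i` whose
coefficients are polynomials in the `w`. -/
noncomputable def tensorFun {n m : ℕ} (p : Fin n → PowerSeries (MvPolynomial (Fin m) ℚ)) :
    MvPowerSeries (Fin n ⊕ Fin m) ℚ := fun D =>
  MvPolynomial.coeff (Finsupp.sumFinsuppEquivProdFinsupp D).2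
    (∏ i, PowerSeries.coeff (D (Sum.inl i)) (p i))

theorem coeff_tensorFun {n m : ℕ} (p : Fin n → PowerSeries (MvPolynomial (Fin m) ℚ))
    (D : Fin n ⊕ Fin m →₀ ℕ) : MvPowerSeries.coeff D (tensorFun p) =
      MvPolynomial.coeff (Finsupp.sumFinsuppEquivProdFinsupp D).2
        (∏ i, PowerSeries.coeff (D (Sum.inl i)) (p i)) := rfl

/-- `tensorFun` as a monoid homomorphism. -/
noncomputable def tensorSeries (n m : ℕ) :
    (Fin n → PowerSeries (MvPolynomial (Fin m) ℚ)) →* MvPowerSeries (Fin n ⊕ Fin m) ℚ where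
  toFun := tensorFun
  map_one' := by
    classical
    ext D
    rw [MvPowerSeries.coeff_one, coeff_tensorFun]
    simp only [Pi.one_apply]
    by_cases h : ∀ i, D (Sum.inl i) = 0
    · rw [Finset.prod_eq_one fun i _ => by rw [h i]; simp, MvPolynomial.coeff_one]
      refine if_congr ⟨fun h' => ?_, fun h' => ?_⟩ rfl rfl
      · ext (i | j)
        · simpa using h i
        · simpa using (DFunLike.congr_fun h' j).symm
      · ext j
        simp [h']
    · push Not at h
      obtain ⟨i, hi⟩ := h
      rw [Finset.prod_eq_zero (Finset.mem_univ i) (by simp [PowerSeries.coeff_one, hi]),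
        MvPolynomial.coeff_zero, if_neg]
      rintro rfl
      simp at hi
  map_mul' p q := by
    classical
    ext D
    rw [MvPowerSeries.coeff_mul]
    simp only [coeff_tensorFun, Pi.mul_apply]
    simp only [PowerSeries.coeff_mul]
    rw [Finset.prod_univ_sum, MvPolynomial.coeff_sum]
    simp only [Finset.prod_mul_distrib, MvPolynomial.coeff_mul]
    rw [Finset.sum_sigma']
    -- Splitting a joint exponent amounts to splitting each `y` exponent separately and the `w`
    -- exponent as a whole.
    refine Finset.sum_bij'
      (fun x _ => (Finsupp.sumElim (Finsupp.equivFunOnFinite.symm fun i => (x.1 i).1) x.2.1,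
        Finsupp.sumElim (Finsupp.equivFunOnFinite.symm fun i => (x.1 i).2) x.2.2))
      (fun E _ => ⟨fun i => (E.1 (Sum.inl i), E.2 (Sum.inl i)),
        ((Finsupp.sumFinsuppEquivProdFinsupp E.1).2, (Finsupp.sumFinsuppEquivProdFinsupp E.2).2)⟩)
      ?_ ?_ ?_ ?_ ?_
    · rintro ⟨c, e⟩ h
      simp only [Finset.mem_sigma, Fintype.mem_piFinset, Finset.HasAntidiagonal.mem_antidiagonal] at h ⊢
      ext (i | j)
      · simpa using h.1 i
      · simpa using DFunLike.congr_fun h.2 j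
    · rintro ⟨E1, E2⟩ h
      simp only [Finset.mem_sigma, Fintype.mem_piFinset, Finset.HasAntidiagonal.mem_antidiagonal] at h ⊢
      refine ⟨fun i => DFunLike.congr_fun h _, ?_⟩
      ext j
      simpa using DFunLike.congr_fun h (Sum.inr j)
    · rintro ⟨c, e1, e2⟩ h
      simp only [Sigma.mk.injEq, heq_eq_eq, Prod.mk.injEq]
      refine ⟨?_, ?_, ?_⟩
      · funext i
        simp
      · ext j
        simp
      · ext j
        simp
    · rintro ⟨E1, E2⟩ h
      simp only [Prod.mk.injEq]
      constructor <;> ext (i | j) <;> simp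
    · rintro ⟨c, e1, e2⟩ h
      have h1 : ∀ (f : Fin n →₀ ℕ) (e : Fin m →₀ ℕ),
          (Finsupp.sumFinsuppEquivProdFinsupp (Finsupp.sumElim f e)).2 = e := by
        intro f e
        ext j
        simp
      simp only [h1]
      simp

theorem coeff_tensorSeries {n m : ℕ} (p : Fin n → PowerSeries (MvPolynomial (Fin m) ℚ))
    (D : Fin n ⊕ Fin m →₀ ℕ) : MvPowerSeries.coeff D (tensorSeries n m p) =
      MvPolynomial.coeff (Finsupp.sumFinsuppEquivProdFinsupp D).2
        (∏ i, PowerSeries.coeff (D (Sum.inl i)) (p i)) := rfl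

/-- Substitution of `y_i` for the variable of a power series with coefficients polynomials in the
`w`. -/
noncomputable def substY {n : ℕ} (m : ℕ) (i : Fin n) :
    PowerSeries (MvPolynomial (Fin m) ℚ) →+* MvPowerSeries (Fin n ⊕ Fin m) ℚ where
  toMonoidHom := (tensorSeries n m).comp (MonoidHom.mulSingle (fun _ => PowerSeries (MvPolynomial (Fin m) ℚ)) i)
  map_zero' := by
    ext D
    change MvPowerSeries.coeff D (tensorSeries n m (Pi.mulSingle i 0)) = 0
    rw [coeff_tensorSeries, Finset.prod_eq_zero (Finset.mem_univ i) (by simp), MvPolynomial.coeff_zero]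
  map_add' p q := by
    ext D
    change MvPowerSeries.coeff D (tensorSeries n m (Pi.mulSingle i (p + q))) =
      MvPowerSeries.coeff D (tensorSeries n m (Pi.mulSingle i p) + tensorSeries n m (Pi.mulSingle i q))
    rw [map_add]
    simp only [coeff_tensorSeries, ← MvPolynomial.coeff_add]
    congr 1
    have h : ∀ r : PowerSeries (MvPolynomial (Fin m) ℚ),
        ∏ l, PowerSeries.coeff (D (Sum.inl l)) (Pi.mulSingle (M := fun _ => PowerSeries (MvPolynomial (Fin m) ℚ)) i r l) =
        PowerSeries.coeff (D (Sum.inl i)) r * ∏ l ∈ Finset.univ.erase i,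
          PowerSeries.coeff (D (Sum.inl l)) (1 : PowerSeries (MvPolynomial (Fin m) ℚ)) := by
      intro r
      rw [← Finset.mul_prod_erase _ _ (Finset.mem_univ i), Pi.mulSingle_eq_same]
      congr 1
      refine Finset.prod_congr rfl fun l hl => ?_
      rw [Pi.mulSingle_eq_of_ne (Finset.ne_of_mem_erase hl)]
    rw [h, h, h, map_add, add_mul]

/-- This lets coefficients of a determinant whose row `i` involves only `y_i` be read off row by
row. -/
theorem prod_substY {n m : ℕ} (p : Fin n → PowerSeries (MvPolynomial (Fin m) ℚ)) :
    ∏ i, substY m i (p i) = tensorSeries n m p := by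
  change ∏ i, tensorSeries n m (Pi.mulSingle i (p i)) = _
  rw [← map_prod, Finset.univ_prod_mulSingle]

theorem coeff_substY {n m : ℕ} (i : Fin n) (p : PowerSeries (MvPolynomial (Fin m) ℚ))
    (D : Fin n ⊕ Fin m →₀ ℕ) : MvPowerSeries.coeff D (substY m i p) =
      if ∀ l, l ≠ i → D (Sum.inl l) = 0 then
        MvPolynomial.coeff (Finsupp.sumFinsuppEquivProdFinsupp D).2
          (PowerSeries.coeff (D (Sum.inl i)) p) else 0 := by
  change MvPowerSeries.coeff D (tensorSeries n m (Pi.mulSingle i p)) = _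
  rw [coeff_tensorSeries]
  split_ifs with h
  · rw [Finset.prod_eq_single i]
    · rw [Pi.mulSingle_eq_same]
    · intro l _ hl
      rw [Pi.mulSingle_eq_of_ne hl, h l hl]
      simp
    · simp
  · push Not at h
    obtain ⟨l, hl, h0⟩ := h
    rw [Finset.prod_eq_zero (Finset.mem_univ l), MvPolynomial.coeff_zero]
    rw [Pi.mulSingle_eq_of_ne hl, PowerSeries.coeff_one, if_neg h0]

theorem substY_X {n : ℕ} (m : ℕ) (i : Fin n) :
    substY m i PowerSeries.X = MvPowerSeries.X (Sum.inl i) := by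
  classical
  ext D
  rw [coeff_substY, MvPowerSeries.coeff_X, PowerSeries.coeff_X]
  by_cases h : D = Finsupp.single (Sum.inl i) 1
  · subst h
    rw [if_pos fun l hl => by simp [Ne.symm hl], if_pos (by simp), if_pos rfl,
      MvPolynomial.coeff_one, if_pos]
    ext j
    simp
  · rw [if_neg h]
    split_ifs with h1 h2
    · rw [MvPolynomial.coeff_one, if_neg]
      intro h3
      refine h ?_
      ext (l | j)
      · by_cases hl : l = i
        · subst hl
          simpa using h2
        · simpa [Finsupp.single_apply, Ne.symm hl] using h1 l hl
      · simpa using (DFunLike.congr_fun h3 j).symm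
    · simp
    · rfl

theorem substY_C_X {n m : ℕ} (i : Fin n) (j : Fin m) :
    substY m i (PowerSeries.C (MvPolynomial.X j)) = MvPowerSeries.X (Sum.inr j) := by
  classical
  ext D
  rw [coeff_substY, MvPowerSeries.coeff_X, PowerSeries.coeff_C]
  by_cases h : D = Finsupp.single (Sum.inr j) 1
  · subst h
    rw [if_pos fun l hl => by simp, if_pos (by simp), if_pos rfl, MvPolynomial.coeff_X, if_pos]
    ext j'
    simp [Finsupp.single_apply]
  · rw [if_neg h]
    split_ifs with h1 h2
    · rw [MvPolynomial.coeff_X, if_neg]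
      intro h3
      refine h ?_
      ext (l | j')
      · by_cases hl : l = i
        · subst hl
          simpa using h2
        · simpa using h1 l hl
      · simpa [Finsupp.single_apply] using (DFunLike.congr_fun h3 j').symm
    · simp
    · rfl

/-! ### Sorting exponent vectors and coefficients of alternants -/

theorem BoundedPartition.addDelta_self {n : ℕ} (μ : BoundedPartition n) (i : Fin n) :
    μ.addDelta n i = μ.1 i + (n - 1 - i) := by
  simp [BoundedPartition.addDelta, BoundedPartition.get]

theorem BoundedPartition.addDelta_strictAnti {n : ℕ} (μ : BoundedPartition n) :
    StrictAnti (μ.addDelta n) := by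
  intro i j hij
  rw [addDelta_self, addDelta_self]
  have := μ.2 hij.le
  have : (i : ℕ) < j := hij
  omega

theorem BoundedPartition.addDelta_injective {n : ℕ} :
    Function.Injective fun μ : BoundedPartition n => μ.addDelta n := by
  intro μ ν h
  ext i
  have := congrFun h i
  simp only [addDelta_self] at this
  omega

theorem exists_sort_eq_addDelta {n : ℕ} {d : Fin n → ℕ} (hd : Function.Injective d) :
    ∃ (μ : BoundedPartition n) (τ : Equiv.Perm (Fin n)), d ∘ τ = μ.addDelta n := by
  let τ : Equiv.Perm (Fin n) := Fin.revPerm.trans (Tuple.sort d)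
  have hτ : StrictAnti (d ∘ τ) := by
    have hm : StrictMono (d ∘ Tuple.sort d) :=
      (Tuple.monotone_sort d).strictMono_of_injective (hd.comp (Tuple.sort d).injective)
    intro i j hij
    exact hm (Fin.rev_lt_rev.2 hij)
  -- A strictly decreasing sequence drops by at least one per step. This gives monotonicity after
  -- subtracting `δ`, and shows that the natural subtraction does not truncate.
  have hle : ∀ (b : ℕ) (i j : Fin n), (j : ℕ) = i + b → d (τ j) + b ≤ d (τ i) := by
    intro b
    induction b with
    | zero =>
      intro i j h
      rw [show j = i from Fin.ext (by omega)]
      simp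
    | succ b ih =>
      intro i j h
      have h1 := ih i ⟨i + b, by omega⟩ rfl
      have h2 : d (τ j) < d (τ ⟨i + b, by omega⟩) :=
        hτ (show (⟨i + b, by omega⟩ : Fin n) < j from Fin.lt_def.2 (by simp only; omega))
      omega
  refine ⟨⟨fun i => d (τ i) - (n - 1 - i), ?_⟩, τ, ?_⟩
  · intro i j hij
    have hij' : (i : ℕ) ≤ j := hij
    have := hle (j - i) i j (by omega)
    simp only
    omega
  · funext i
    have := hle (n - 1 - i) i ⟨n - 1, by have := i.pos; omega⟩ (show n - 1 = (i : ℕ) + (n - 1 - i) by omega)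
    rw [BoundedPartition.addDelta_self]
    simp only [Function.comp_apply]
    omega

/-- Strictly decreasing sequences with the same range coincide, and `d` is injective, so the
permutation is determined too. -/
theorem addDelta_sort_unique {n : ℕ} {d : Fin n → ℕ} {μ ν : BoundedPartition n}
    {σ τ : Equiv.Perm (Fin n)} (hμ : d ∘ σ = μ.addDelta n) (hν : d ∘ τ = ν.addDelta n) :
    μ = ν ∧ σ = τ := by
  have h : μ.addDelta n = ν.addDelta n := by
    have h1 : StrictMono (OrderDual.toDual ∘ μ.addDelta n) := μ.addDelta_strictAnti
    have h2 : StrictMono (OrderDual.toDual ∘ ν.addDelta n) := ν.addDelta_strictAnti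
    refine OrderDual.toDual.injective.comp_left ((h1.range_inj h2).1 ?_)
    rw [Set.range_comp, Set.range_comp, ← hμ, ← hν, σ.surjective.range_comp, τ.surjective.range_comp]
  have h3 : μ = ν := BoundedPartition.addDelta_injective h
  refine ⟨h3, Equiv.ext fun i => ?_⟩
  have hd : Function.Injective (d ∘ σ) := hμ ▸ μ.addDelta_strictAnti.injective
  have hd' : Function.Injective d := by
    have := hd.comp σ.symm.injective
    rwa [Function.comp_assoc, Equiv.self_comp_symm, Function.comp_id] at this
  exact hd' ((congrFun (hμ.trans (h.trans hν.symm)) i))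

theorem coeff_alternant {n : ℕ} (α : Fin n → ℕ) (d : Fin n →₀ ℕ) :
    MvPolynomial.coeff d (alternant α) =
      ∑ σ : Equiv.Perm (Fin n), if ⇑d ∘ σ = α then ((Equiv.Perm.sign σ : ℤ) : ℚ) else 0 := by
  classical
  rw [alternant, Matrix.det_apply', MvPolynomial.coeff_sum]
  refine Finset.sum_congr rfl fun σ _ => ?_
  have h : ∏ i, (Matrix.of fun i j : Fin n => (MvPolynomial.X i : MvPolynomial (Fin n) ℚ) ^ α j)
      (σ i) i = MvPolynomial.monomial (Finsupp.equivFunOnFinite.symm (α ∘ σ.symm)) 1 := by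
    rw [MvPolynomial.monomial_eq, Finsupp.prod_fintype _ _ (by simp),
      ← Equiv.prod_comp σ fun i => MvPolynomial.X i ^ _]
    simp
  rw [h, ← map_intCast (MvPolynomial.C (σ := Fin n) (R := ℚ)), MvPolynomial.coeff_C_mul,
    MvPolynomial.coeff_monomial, mul_ite, mul_one, mul_zero]
  refine if_congr ⟨?_, ?_⟩ rfl rfl
  · rintro rfl
    funext i
    simp
  · rintro rfl
    ext i
    simp

theorem coeff_rename_mul_rename {R α β : Type*} [CommSemiring R] (p : MvPolynomial α R)
    (q : MvPolynomial β R) (D : α ⊕ β →₀ ℕ) :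
    MvPolynomial.coeff D (MvPolynomial.rename Sum.inl p * MvPolynomial.rename Sum.inr q) =
      MvPolynomial.coeff (Finsupp.sumFinsuppEquivProdFinsupp D).1 p *
        MvPolynomial.coeff (Finsupp.sumFinsuppEquivProdFinsupp D).2 q := by
  classical
  induction p using MvPolynomial.induction_on' with
  | add p p' hp hp' => simp only [map_add, add_mul, MvPolynomial.coeff_add, hp, hp']
  | monomial a c =>
    induction q using MvPolynomial.induction_on' with
    | add p p' hp hp' => simp only [map_add, mul_add, MvPolynomial.coeff_add, hp, hp']
    | monomial b c' =>
      rw [MvPolynomial.rename_monomial, MvPolynomial.rename_monomial, MvPolynomial.monomial_mul,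
        MvPolynomial.coeff_monomial, MvPolynomial.coeff_monomial, MvPolynomial.coeff_monomial]
      have key : Finsupp.mapDomain Sum.inl a + Finsupp.mapDomain Sum.inr b = D ↔
          a = (Finsupp.sumFinsuppEquivProdFinsupp D).1 ∧
            b = (Finsupp.sumFinsuppEquivProdFinsupp D).2 := by
        have hl : ∀ i, (Finsupp.mapDomain Sum.inl a + Finsupp.mapDomain Sum.inr b : α ⊕ β →₀ ℕ)
            (Sum.inl i) = a i := fun i => by
          rw [Finsupp.add_apply, Finsupp.mapDomain_apply Sum.inl_injective,
            Finsupp.mapDomain_of_notMem_range _ _ (by simp), add_zero]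
        have hr : ∀ i, (Finsupp.mapDomain Sum.inl a + Finsupp.mapDomain Sum.inr b : α ⊕ β →₀ ℕ)
            (Sum.inr i) = b i := fun i => by
          rw [Finsupp.add_apply, Finsupp.mapDomain_apply Sum.inr_injective,
            Finsupp.mapDomain_of_notMem_range _ _ (by simp), zero_add]
        constructor
        · rintro rfl
          constructor <;> ext i
          · simpa using (hl i).symm
          · simpa using (hr i).symm
        · rintro ⟨h1, h2⟩
          ext (i | j)
          · rw [hl, h1]
            simp
          · rw [hr, h2]
            simp
      simp only [key, ite_and]
      split_ifs <;> simp

theorem jacobiTrudi_comp_perm (m : ℕ) {n : ℕ} (d : Fin n → ℕ) (τ : Equiv.Perm (Fin n)) :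
    jacobiTrudi m (d ∘ τ) = ((Equiv.Perm.sign τ : ℤ) : MvPolynomial (Fin m) ℚ) * jacobiTrudi m d := by
  rw [jacobiTrudi, jacobiTrudi, ← Matrix.det_permute]
  rfl

/-! ### The sum times the Vandermonde product as a determinant -/

/-- The sum over partitions of `agjSum` for a rational number `u`. -/
noncomputable def agjEval (n m : ℕ) (u : ℚ) : MvPowerSeries (Fin n ⊕ Fin m) ℚ := fun D =>
  ∑ᶠ μ : BoundedPartition n, (schurProduct m μ).coeff D *
    ∏ i : Fin n, ((μ.addDelta n i : ℚ) + u)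

theorem coeff_agjEval {n m : ℕ} (u : ℚ) (D : Fin n ⊕ Fin m →₀ ℕ) :
    MvPowerSeries.coeff D (agjEval n m u) = ∑ᶠ μ : BoundedPartition n, (schurProduct m μ).coeff D *
      ∏ i : Fin n, ((μ.addDelta n i : ℚ) + u) := rfl

theorem coeff_vandermonde_mul_agjEval {n m : ℕ} (u : ℚ) (D : Fin n ⊕ Fin m →₀ ℕ) :
    MvPowerSeries.coeff D (((MvPolynomial.rename Sum.inl (vandermondeProd n) :
      MvPolynomial (Fin n ⊕ Fin m) ℚ) : MvPowerSeries (Fin n ⊕ Fin m) ℚ) * agjEval n m u) =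
    ∑ᶠ μ : BoundedPartition n,
      MvPolynomial.coeff (Finsupp.sumFinsuppEquivProdFinsupp D).1 (alternant (μ.addDelta n)) *
      MvPolynomial.coeff (Finsupp.sumFinsuppEquivProdFinsupp D).2 (schur m μ) *
      ∏ i : Fin n, ((μ.addDelta n i : ℚ) + u) := by
  classical
  let P : MvPolynomial (Fin n ⊕ Fin m) ℚ := MvPolynomial.rename Sum.inl (vandermondeProd n)
  -- One finite set of partitions that suffices for all splittings of `D`, so that the two sums can
  -- be interchanged.
  let S : Finset (BoundedPartition n) := (Finset.HasAntidiagonal.antidiagonal D).biUnion fun E =>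
    (schurProduct_coeff_finite (m := m) E.2).toFinset
  have hterm : ∀ μ : BoundedPartition n, MvPolynomial.coeff D (P * schurProduct m μ) =
      MvPolynomial.coeff (Finsupp.sumFinsuppEquivProdFinsupp D).1 (alternant (μ.addDelta n)) *
      MvPolynomial.coeff (Finsupp.sumFinsuppEquivProdFinsupp D).2 (schur m μ) := by
    intro μ
    rw [schurProduct, ← mul_assoc, ← map_mul, vandermondeProd_mul_schur μ fun i hi => by
      simp [BoundedPartition.get, not_lt.2 hi], coeff_rename_mul_rename]
  have hS : ∀ μ, μ ∉ S → ∀ E ∈ Finset.HasAntidiagonal.antidiagonal D, MvPolynomial.coeff E.2 (schurProduct m μ) = 0 := by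
    intro μ hμ E hE
    by_contra h0
    exact hμ (Finset.mem_biUnion.2 ⟨E, hE, by simpa using h0⟩)
  simp only [← hterm]
  rw [MvPowerSeries.coeff_mul, finsum_eq_sum_of_support_subset (s := S)]
  · simp only [MvPolynomial.coeff_mul, Finset.sum_mul]
    rw [Finset.sum_comm]
    refine Finset.sum_congr rfl fun E hE => ?_
    rw [coeff_agjEval, finsum_eq_sum_of_support_subset (s := S), Finset.mul_sum, MvPolynomial.coeff_coe]
    · exact Finset.sum_congr rfl fun μ _ => (mul_assoc _ _ _).symm
    · intro μ hμ
      by_contra h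
      exact hμ (by simp only [hS μ h E hE, zero_mul])
  · intro μ hμ
    by_contra h
    refine hμ ?_
    simp only
    rw [MvPolynomial.coeff_mul, Finset.sum_eq_zero fun E hE => by rw [hS μ h E hE, mul_zero], zero_mul]

/-- The series `(θ + u) (X ^ e H)` with `θ = X d/dX`. -/
noncomputable def eulerSeries (m e : ℕ) (u : ℚ) : PowerSeries (MvPolynomial (Fin m) ℚ) :=
  PowerSeries.mk fun r => MvPolynomial.C ((r : ℚ) + u) *
    PowerSeries.coeff r (PowerSeries.X ^ e * completeSeries m)

/-- Row `i` involves only `y_i` among the `y`, and `θ + u` multiplies the coefficient of `y_i^d` by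
`d + u`. -/
theorem coeff_det_substY {n m : ℕ} (u : ℚ) (D : Fin n ⊕ Fin m →₀ ℕ) :
    MvPowerSeries.coeff D (Matrix.of fun i j : Fin n =>
      substY m i (eulerSeries m (n - 1 - (j : ℕ)) u)).det =
    MvPolynomial.coeff (Finsupp.sumFinsuppEquivProdFinsupp D).2
      (jacobiTrudi m fun i : Fin n => D (Sum.inl i)) * ∏ i, ((D (Sum.inl i) : ℚ) + u) := by
  have h := Matrix.det_mul_column (fun i : Fin n => MvPolynomial.C (σ := Fin m) ((D (Sum.inl i) : ℚ) + u))
    (Matrix.of fun i j : Fin n => PowerSeries.coeff (D (Sum.inl i))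
      (PowerSeries.X ^ (n - 1 - (j : ℕ)) * completeSeries m))
  rw [← map_prod] at h
  rw [mul_comm, ← MvPolynomial.coeff_C_mul, jacobiTrudi, ← h, ← Matrix.det_transpose,
    ← Matrix.det_transpose (Matrix.of _), Matrix.det_apply', Matrix.det_apply', map_sum,
    MvPolynomial.coeff_sum]
  refine Finset.sum_congr rfl fun σ _ => ?_
  rw [← map_intCast (MvPolynomial.C (σ := Fin m) (R := ℚ)), MvPolynomial.coeff_C_mul,
    ← map_intCast (MvPowerSeries.C (σ := Fin n ⊕ Fin m) (R := ℚ)), MvPowerSeries.coeff_C_mul]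
  congr 1
  simp only [Matrix.transpose_apply, Matrix.of_apply]
  rw [prod_substY fun i => eulerSeries m (n - 1 - (σ i : ℕ)) u, coeff_tensorSeries]
  simp only [eulerSeries, PowerSeries.coeff_mk]

/-- Compare coefficients of `y^d`. If the entries of `d` are distinct, a single partition and
permutation contribute, and the sign from the alternant cancels the one from sorting the
Jacobi–Trudi rows. Otherwise both sides vanish, the right one having two equal rows. -/
theorem vandermonde_mul_agjEval (n m : ℕ) (u : ℚ) :
    ((MvPolynomial.rename Sum.inl (vandermondeProd n) :
      MvPolynomial (Fin n ⊕ Fin m) ℚ) : MvPowerSeries (Fin n ⊕ Fin m) ℚ) * agjEval n m u =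
    (Matrix.of fun i j : Fin n => substY m i (eulerSeries m (n - 1 - (j : ℕ)) u)).det := by
  classical
  ext D
  rw [coeff_vandermonde_mul_agjEval, coeff_det_substY]
  set d := (Finsupp.sumFinsuppEquivProdFinsupp D).1
  have hdD : (fun i => D (Sum.inl i)) = ⇑d := by
    funext i
    simp [d]
  rw [hdD]
  simp only [congrFun hdD]
  by_cases hd : Function.Injective d
  · obtain ⟨μ, τ, h⟩ := exists_sort_eq_addDelta hd
    have hc : ∀ ν : BoundedPartition n, MvPolynomial.coeff d (alternant (ν.addDelta n)) =
        if ν = μ then ((Equiv.Perm.sign τ : ℤ) : ℚ) else 0 := by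
      intro ν
      rw [coeff_alternant]
      split_ifs with hν
      · subst hν
        rw [Finset.sum_eq_single τ, if_pos h]
        · intro σ _ hσ
          rw [if_neg]
          exact fun h' => hσ (addDelta_sort_unique h' h).2
        · simp
      · refine Finset.sum_eq_zero fun σ _ => if_neg fun h' => ?_
        exact hν (addDelta_sort_unique h' h).1
    rw [finsum_eq_single _ μ fun ν hν => by rw [hc, if_neg hν, zero_mul, zero_mul], hc, if_pos rfl,
      schur_eq_jacobiTrudi, ← h, jacobiTrudi_comp_perm,
      ← map_intCast (MvPolynomial.C (σ := Fin m) (R := ℚ)), MvPolynomial.coeff_C_mul, ← mul_assoc,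
      ← Int.cast_mul, ← Units.val_mul, Int.units_mul_self, Units.val_one, Int.cast_one, one_mul]
    congr 1
    exact Equiv.prod_comp τ fun i => ((d i : ℚ) + u)
  · have hc : ∀ ν : BoundedPartition n, MvPolynomial.coeff d (alternant (ν.addDelta n)) = 0 := by
      intro ν
      rw [coeff_alternant]
      refine Finset.sum_eq_zero fun σ _ => if_neg fun h' => hd ?_
      have h1 : Function.Injective (d ∘ σ) := h' ▸ ν.addDelta_strictAnti.injective
      have := h1.comp σ.symm.injective
      rwa [Function.comp_assoc, Equiv.self_comp_symm, Function.comp_id] at this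
    simp only [hc, zero_mul, finsum_zero]
    rw [Function.Injective] at hd
    push Not at hd
    obtain ⟨a, b, hab, hne⟩ := hd
    rw [jacobiTrudi, Matrix.det_zero_of_row_eq hne (by funext j; simp [hab]), MvPolynomial.coeff_zero,
      zero_mul]

/-! ### The Euler operator and the Cauchy kernel -/

/-- Obtained by differentiating `geomSeries a * (1 - a X) = 1`; together with the Leibniz rule it
gives the logarithmic derivative of `H`. -/
theorem X_mul_derivative_geomSeries {R : Type*} [CommRing R] (a : R) :
    PowerSeries.X * PowerSeries.derivative R (geomSeries a) =
      geomSeries a * (PowerSeries.C a * PowerSeries.X * geomSeries a) := by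
  have h := geomSeries_mul a
  have h1 := congrArg (PowerSeries.derivative R) h
  rw [Derivation.leibniz] at h1
  simp only [map_sub, Derivation.leibniz, smul_eq_mul, PowerSeries.derivative_C,
    PowerSeries.derivative_X, Derivation.map_one_eq_zero] at h1
  linear_combination (PowerSeries.X * geomSeries a) * h1 -
    PowerSeries.X * PowerSeries.derivative R (geomSeries a) * h

theorem X_mul_derivative_prod_geomSeries {R ι : Type*} [CommRing R] (s : Finset ι) (a : ι → R) :
    PowerSeries.X * PowerSeries.derivative R (∏ j ∈ s, geomSeries (a j)) =
      (∏ j ∈ s, geomSeries (a j)) *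
        ∑ j ∈ s, PowerSeries.C (a j) * PowerSeries.X * geomSeries (a j) := by
  classical
  induction s using Finset.induction_on with
  | empty => simp
  | insert j s hj ih =>
    rw [Finset.prod_insert hj, Finset.sum_insert hj, Derivation.leibniz, smul_eq_mul, smul_eq_mul]
    linear_combination geomSeries (a j) * ih +
      (∏ j ∈ s, geomSeries (a j)) * X_mul_derivative_geomSeries (a j)

theorem eulerSeries_eq (m e : ℕ) (u : ℚ) :
    eulerSeries m e u = completeSeries m * (((e : PowerSeries (MvPolynomial (Fin m) ℚ)) +
      (algebraMap ℚ _ u + ∑ j : Fin m, PowerSeries.X * PowerSeries.C (MvPolynomial.X j) *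
        geomSeries (MvPolynomial.X j))) * PowerSeries.X ^ e) := by
  have h1 : eulerSeries m e u = PowerSeries.X * PowerSeries.derivative _
      (PowerSeries.X ^ e * completeSeries m) +
        PowerSeries.C (MvPolynomial.C u) * (PowerSeries.X ^ e * completeSeries m) := by
    ext1 r
    rw [map_add, PowerSeries.coeff_C_mul, eulerSeries, PowerSeries.coeff_mk, map_add, add_mul]
    congr 1
    rcases r with _ | r
    · simp
    · rw [PowerSeries.coeff_succ_X_mul, PowerSeries.coeff_derivative, mul_comm]
      simp
  have h2 : PowerSeries.X * PowerSeries.derivative (MvPolynomial (Fin m) ℚ) (PowerSeries.X ^ e) =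
      (e : PowerSeries (MvPolynomial (Fin m) ℚ)) * PowerSeries.X ^ e := by
    rcases e with _ | e
    · simp
    · rw [Derivation.leibniz_pow]
      simp [pow_succ]
      ring
  have h3 := X_mul_derivative_prod_geomSeries Finset.univ
    fun j => (MvPolynomial.X j : MvPolynomial (Fin m) ℚ)
  rw [← completeSeries] at h3
  -- Ring homomorphisms out of `ℚ` are unique.
  have h4 : algebraMap ℚ (PowerSeries (MvPolynomial (Fin m) ℚ)) u = PowerSeries.C (MvPolynomial.C u) :=
    RingHom.congr_fun (Subsingleton.elim _ (PowerSeries.C.comp MvPolynomial.C)) u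
  simp only [mul_comm PowerSeries.X (PowerSeries.C _)]
  rw [h1, Derivation.leibniz, smul_eq_mul, smul_eq_mul, h4]
  linear_combination completeSeries m * h2 + PowerSeries.X ^ e * h3

theorem one_sub_yw_inv_mul {n m : ℕ} (i : Fin n) (j : Fin m) : (1 - yw i j)⁻¹ * (1 - yw i j) = 1 :=
  MvPowerSeries.inv_mul_cancel _ (by simp [yw])

theorem substY_geomSeries {n m : ℕ} (i : Fin n) (j : Fin m) :
    substY m i (geomSeries (MvPolynomial.X j)) = (1 - yw i j)⁻¹ := by
  have h := congrArg (substY m i) (geomSeries_mul (MvPolynomial.X j : MvPolynomial (Fin m) ℚ))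
  rw [map_mul, map_sub, map_one, map_mul, substY_C_X, substY_X, mul_comm (MvPowerSeries.X _), ← yw] at h
  linear_combination (1 - yw i j)⁻¹ * h - substY m i (geomSeries (MvPolynomial.X j)) * one_sub_yw_inv_mul i j

theorem substY_algebraMap {n : ℕ} (m : ℕ) (i : Fin n) (u : ℚ) :
    substY m i (algebraMap ℚ _ u) = algebraMap ℚ _ u :=
  RingHom.congr_fun (Subsingleton.elim ((substY m i).comp (algebraMap ℚ _)) (algebraMap ℚ _)) u

theorem coe_rename_vandermondeProd (n m : ℕ) :
    ((MvPolynomial.rename Sum.inl (vandermondeProd n) :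
      MvPolynomial (Fin n ⊕ Fin m) ℚ) : MvPowerSeries (Fin n ⊕ Fin m) ℚ) =
      vdet fun i : Fin n => (MvPowerSeries.X (Sum.inl i) : MvPowerSeries (Fin n ⊕ Fin m) ℚ) := by
  rw [← alternant_delta, alternant, AlgHom.map_det, ← MvPolynomial.coeToMvPowerSeries.ringHom_apply,
    RingHom.map_det, vdet]
  congr 1
  ext1 i j
  simp

theorem det_substY_eulerSeries (n m : ℕ) (u : ℚ) :
    (Matrix.of fun i j : Fin n => substY m i (eulerSeries m (n - 1 - (j : ℕ)) u)).det =
    cauchyKernel n m * shiftedVdet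
      (fun i : Fin n => (MvPowerSeries.X (Sum.inl i) : MvPowerSeries (Fin n ⊕ Fin m) ℚ)) fun i =>
        algebraMap ℚ _ u + ∑ j : Fin m, MvPowerSeries.X (Sum.inl i) * MvPowerSeries.X (Sum.inr j) *
          (1 - yw i j)⁻¹ := by
  rw [cauchyKernel, shiftedVdet, ← Matrix.det_mul_column]
  congr 1
  ext1 i j
  rw [Matrix.of_apply, Matrix.of_apply, Matrix.of_apply, eulerSeries_eq, completeSeries]
  simp only [map_mul, map_prod, map_add, map_sum, map_pow, map_natCast, substY_X, substY_C_X,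
    substY_geomSeries, substY_algebraMap]

theorem kernelSum_eq (n m k : ℕ) : kernelSum n m k = cauchyKernel n m * matchSum k
    fun (i : Fin n) (j : Fin m) => MvPowerSeries.X (Sum.inl i) * MvPowerSeries.X (Sum.inr j) *
      (1 - yw i j)⁻¹ := by
  rw [kernelSum, matchSum_eq]
  rfl

/-! ### Expansion in rising and falling factorials -/

theorem agjEval_eq (n m : ℕ) (u : ℚ) :
    agjEval n m u = ∑ k ∈ Finset.range (n + 1),
      ((ascPochhammer ℚ (n - k)).eval u) • kernelSum n m k := by
  have hv : ((MvPolynomial.rename Sum.inl (vandermondeProd n) :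
      MvPolynomial (Fin n ⊕ Fin m) ℚ) : MvPowerSeries (Fin n ⊕ Fin m) ℚ) ≠ 0 := by
    rw [Ne, MvPolynomial.coe_eq_zero_iff, ← map_zero (MvPolynomial.rename Sum.inl),
      (MvPolynomial.rename_injective _ Sum.inl_injective).eq_iff]
    exact vandermondeProd_ne_zero n
  refine mul_left_cancel₀ hv ?_
  rw [vandermonde_mul_agjEval, det_substY_eulerSeries, shiftedVdet_eq _ _
    (fun j : Fin m => MvPowerSeries.X (Sum.inr j)) (fun i j => (1 - yw i j)⁻¹)
    fun i j => one_sub_yw_inv_mul i j, coe_rename_vandermondeProd, mul_left_comm]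
  congr 1
  rw [Finset.mul_sum]
  refine Finset.sum_congr rfl fun k _ => ?_
  rw [kernelSum_eq, Algebra.smul_def, mul_left_comm]
  congr 1
  rw [← ascPochhammer_map (algebraMap ℚ _), Polynomial.eval_map_algebraMap, Polynomial.aeval_algebraMap_apply]
  simp

theorem eval_coeff_agjSum {n m : ℕ} (D : Fin n ⊕ Fin m →₀ ℕ) (x : ℚ) :
    (MvPowerSeries.coeff D (agjSum n m (-Polynomial.X))).eval x =
      MvPowerSeries.coeff D (agjEval n m (-x)) := by
  rw [coeff_agjEval]
  change (Polynomial.evalRingHom x).toAddMonoidHom (∑ᶠ μ : BoundedPartition n, _) = _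
  rw [AddMonoidHom.map_finsum]
  · refine finsum_congr fun μ => ?_
    change Polynomial.eval x _ = _
    rw [Polynomial.eval_smul, Polynomial.eval_prod, smul_eq_mul]
    simp [BoundedPartition.addDelta_self]
  · refine (schurProduct_coeff_finite (m := m) D).subset fun μ hμ => ?_
    intro h
    exact hμ (by simp only [h, zero_smul])

/-- The expansion holds at every rational `x`, hence as polynomials, and the rising factorial at
`-x` is a signed falling factorial. -/
theorem fallingCoeff_agjSum (n m k : ℕ) (hk : k ≤ n) :
    fallingCoeff (n - k) (agjSum n m (-Polynomial.X)) = (-1) ^ (n - k) * kernelSum n m k := by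
  ext D
  have h : MvPowerSeries.coeff D (agjSum n m (-Polynomial.X)) = ∑ l ∈ Finset.range (n + 1),
      ((-1) ^ (n - l) * MvPowerSeries.coeff D (kernelSum n m l)) • fallingBasis (n - l) := by
    refine Polynomial.funext fun x => ?_
    rw [eval_coeff_agjSum, agjEval_eq, map_sum, Polynomial.eval_finsetSum]
    refine Finset.sum_congr rfl fun l _ => ?_
    rw [map_smul, ascPochhammer_eval_neg_eq_descPochhammer, fallingBasis_apply, Polynomial.eval_smul,
      smul_eq_mul, smul_eq_mul]
    ring
  change fallingBasis.repr _ (n - k) = _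
  rw [h, map_sum, Finsupp.finsetSum_apply, Finset.sum_eq_single k]
  · rw [map_smul, Module.Basis.repr_self, Finsupp.smul_apply, Finsupp.single_eq_same, smul_eq_mul, mul_one]
    rw [← map_one MvPowerSeries.C, ← map_neg, ← map_pow, MvPowerSeries.coeff_C_mul]
  · intro l hl hlk
    rw [map_smul, Module.Basis.repr_self, Finsupp.smul_apply, Finsupp.single_eq_of_ne, smul_zero]
    -- The bounds `l ≤ n` and `k ≤ n` are what make `n - l = n - k` force `l = k`.
    rw [Finset.mem_range] at hl
    omega
  · intro h
    exact (h (Finset.mem_range.2 (by omega))).elim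

/-! ### The squarefree coefficient in the `w` -/

/-- The power series in which no monomial has `w`-exponent bounded by `e`. -/
def wTruncIdeal {n m : ℕ} (e : Fin m →₀ ℕ) : Ideal (MvPowerSeries (Fin n ⊕ Fin m) ℚ) where
  carrier := {F | ∀ D : Fin n ⊕ Fin m →₀ ℕ, (∀ j, D (Sum.inr j) ≤ e j) → MvPowerSeries.coeff D F = 0}
  zero_mem' := fun D _ => map_zero _
  add_mem' := fun ha hb D hD => by rw [map_add, ha D hD, hb D hD, add_zero]
  smul_mem' := fun G F hF D hD => by
    classical
    rw [smul_eq_mul, MvPowerSeries.coeff_mul]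
    refine Finset.sum_eq_zero fun E hE => ?_
    rw [hF E.2 fun j => ?_, mul_zero]
    have := DFunLike.congr_fun (Finset.HasAntidiagonal.mem_antidiagonal.1 hE) (Sum.inr j)
    rw [Finsupp.add_apply] at this
    have := hD j
    omega

theorem X_inr_sq_mem_wTruncIdeal {n m : ℕ} {e : Fin m →₀ ℕ} {j : Fin m} (h : e j ≤ 1) :
    (MvPowerSeries.X (Sum.inr j) : MvPowerSeries (Fin n ⊕ Fin m) ℚ) ^ 2 ∈ wTruncIdeal e := by
  intro D hD
  refine MvPowerSeries.X_pow_dvd_iff.1 dvd_rfl D ?_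
  have := hD j
  omega

theorem coeff_eq_of_quotient_eq {n m : ℕ} {e : Fin m →₀ ℕ} {F G : MvPowerSeries (Fin n ⊕ Fin m) ℚ}
    (h : Ideal.Quotient.mk (wTruncIdeal e) F = Ideal.Quotient.mk (wTruncIdeal e) G) (d : Fin n →₀ ℕ) :
    MvPowerSeries.coeff (Finsupp.sumElim d e) F = MvPowerSeries.coeff (Finsupp.sumElim d e) G := by
  rw [← sub_eq_zero, ← map_sub]
  exact (Ideal.Quotient.eq.1 h) _ fun j => by simp

theorem prod_one_add_mul_of_sq_eq_zero {R ι : Type*} [CommRing R] (s : Finset ι) (y : ι → R) {w : R}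
    (hw : w ^ 2 = 0) : ∏ i ∈ s, (1 + y i * w) = 1 + (∑ i ∈ s, y i) * w := by
  classical
  induction s using Finset.induction_on with
  | empty => simp
  | insert i s hi ih =>
    rw [Finset.prod_insert hi, Finset.sum_insert hi, ih]
    linear_combination (y i * ∑ i ∈ s, y i) * hw

theorem sum_orderEmb_prod_eq_esymm (n k : ℕ) :
    ∑ j : Fin k ↪o Fin n, ∏ r, (MvPolynomial.X (j r) : MvPolynomial (Fin n) ℚ) =
      MvPolynomial.esymm (Fin n) ℚ k := by
  rw [MvPolynomial.esymm]
  refine Finset.sum_bij (fun j _ => Finset.univ.map j.toEmbedding) ?_ ?_ ?_ ?_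
  · intro j _
    simp [Finset.mem_powersetCard]
  · intro j _ j' _ h
    rw [← OrderEmbedding.range_inj]
    have := congrArg (fun s : Finset (Fin n) => (s : Set (Fin n))) h
    simpa using this
  · intro t ht
    refine ⟨t.orderEmbOfFin (Finset.mem_powersetCard.1 ht).2, Finset.mem_univ _, ?_⟩
    apply Finset.coe_injective
    simp
  · intro j _
    rw [Finset.prod_map]
    rfl

/-- Modulo the ideal every `w_j²` vanishes, so `(1 - y_i w_j)⁻¹` becomes `1 + y_i w_j` and `y_i w_j
(1 - y_i w_j)⁻¹` becomes `y_i w_j`. -/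
theorem quotient_kernelSum {n m : ℕ} (k : ℕ) {e : Fin m →₀ ℕ} (he : ∀ j, e j ≤ 1) :
    Ideal.Quotient.mk (wTruncIdeal e) (kernelSum n m k) = Ideal.Quotient.mk (wTruncIdeal e)
      (((∏ j : Fin m, (1 + MvPolynomial.rename Sum.inl (∑ i : Fin n, MvPolynomial.X i) *
          MvPolynomial.X (Sum.inr j))) *
        (MvPolynomial.rename Sum.inl (MvPolynomial.esymm (Fin n) ℚ k) *
          ∑ b : Fin k ↪ Fin m, ∏ r, MvPolynomial.X (Sum.inr (b r))) :
        MvPolynomial (Fin n ⊕ Fin m) ℚ) : MvPowerSeries (Fin n ⊕ Fin m) ℚ) := by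
  set π := Ideal.Quotient.mk (wTruncIdeal (n := n) e)
  have hw : ∀ j, π (MvPowerSeries.X (Sum.inr j)) ^ 2 = 0 := fun j => by
    rw [← map_pow]
    exact Ideal.Quotient.eq_zero_iff_mem.2 (X_inr_sq_mem_wTruncIdeal (he j))
  have hinv : ∀ (i : Fin n) (j : Fin m), π (1 - yw i j)⁻¹ =
      1 + π (MvPowerSeries.X (Sum.inl i)) * π (MvPowerSeries.X (Sum.inr j)) := by
    intro i j
    have h := congrArg π (one_sub_yw_inv_mul i j)
    rw [map_mul, map_sub, map_one, yw, map_mul] at h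
    rw [yw]
    linear_combination (1 + π (MvPowerSeries.X (Sum.inl i)) * π (MvPowerSeries.X (Sum.inr j))) * h +
      π (1 - MvPowerSeries.X (Sum.inl i) * MvPowerSeries.X (Sum.inr j))⁻¹ *
        π (MvPowerSeries.X (Sum.inl i)) ^ 2 * hw j
  have hyw : ∀ (i : Fin n) (j : Fin m), π (yw i j * (1 - yw i j)⁻¹) =
      π (MvPowerSeries.X (Sum.inl i)) * π (MvPowerSeries.X (Sum.inr j)) := by
    intro i j
    rw [map_mul, hinv, yw, map_mul]
    linear_combination π (MvPowerSeries.X (Sum.inl i)) ^ 2 * hw j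
  rw [← sum_orderEmb_prod_eq_esymm, kernelSum, cauchyKernel, Finset.prod_comm]
  simp only [← MvPolynomial.coeToMvPowerSeries.ringHom_apply, map_mul, map_prod, map_sum, map_add,
    map_one, MvPolynomial.rename_X, hinv, hyw]
  simp only [MvPolynomial.coeToMvPowerSeries.ringHom_apply, MvPolynomial.coe_X]
  congr 1
  · refine Finset.prod_congr rfl fun j _ => ?_
    rw [prod_one_add_mul_of_sq_eq_zero _ _ (hw j)]
  · rw [Finset.sum_mul_sum]
    simp only [Finset.prod_mul_distrib]

/-- The indicator of a finite set as an exponent vector. -/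
noncomputable def indicatorExp {σ : Type*} (S : Finset σ) : σ →₀ ℕ :=
  ∑ j ∈ S, Finsupp.single j 1

theorem indicatorExp_apply {σ : Type*} [DecidableEq σ] (S : Finset σ) (j : σ) :
    indicatorExp S j = if j ∈ S then 1 else 0 := by
  simp [indicatorExp, Finsupp.single_apply]

theorem prod_X_eq_monomial {σ : Type*} (S : Finset σ) :
    ∏ j ∈ S, (MvPolynomial.X j : MvPolynomial σ ℚ) = MvPolynomial.monomial (indicatorExp S) 1 := by
  rw [indicatorExp, MvPolynomial.monomial_sum_one]
  rfl

/-- An indicator has no entry `2`, which forces `T` and `A` to be disjoint. -/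
theorem indicatorExp_add_eq_iff {σ : Type*} [DecidableEq σ] (T A S : Finset σ) :
    indicatorExp T + indicatorExp A = indicatorExp S ↔ A ⊆ S ∧ T = S \ A := by
  rw [Finsupp.ext_iff]
  simp only [Finsupp.add_apply, indicatorExp_apply]
  constructor
  · intro h
    constructor
    · intro j hj
      have := h j
      by_contra hS
      simp [hj, hS] at this
    · ext j
      have := h j
      rw [Finset.mem_sdiff]
      split_ifs at this <;> simp_all
  · rintro ⟨h, rfl⟩ j
    by_cases hA : j ∈ A
    · simp [hA, h hA]
    · simp [hA]

theorem card_emb_subset (k : ℕ) {n m : ℕ} (h : n ≤ m) :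
    (Finset.univ.filter fun b : Fin k ↪ Fin m =>
      Finset.univ.map b ⊆ Finset.univ.map (Fin.castLEEmb h)).card = n.descFactorial k := by
  classical
  have h1 : (Finset.univ.filter fun b : Fin k ↪ Fin m =>
      Finset.univ.map b ⊆ Finset.univ.map (Fin.castLEEmb h)) =
      Finset.univ.image fun b : Fin k ↪ Fin n => b.trans (Fin.castLEEmb h) := by
    ext b
    simp only [Finset.mem_filter, Finset.mem_univ, true_and, Finset.mem_image]
    constructor
    · intro hb
      have : ∀ r, ∃ i : Fin n, Fin.castLE h i = b r := fun r => by
        simpa using hb (Finset.mem_map_of_mem b (Finset.mem_univ r))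
      choose f hf using this
      refine ⟨⟨f, fun r s hrs => b.injective ?_⟩, ?_⟩
      · rw [← hf, ← hf, hrs]
      · ext1 r
        exact hf r
    · rintro ⟨b, rfl⟩ j hj
      obtain ⟨r, _, rfl⟩ := Finset.mem_map.1 hj
      exact Finset.mem_map.2 ⟨b r, Finset.mem_univ _, rfl⟩
  rw [h1, Finset.card_image_of_injective, Finset.card_univ, Fintype.card_embedding_eq]
  · simp only [Fintype.card_fin]
  · intro b b' hb
    ext1 r
    exact (Fin.castLEEmb h).injective (DFunLike.congr_fun hb r)

theorem wCoeff_kernelSum {n m : ℕ} (k : ℕ) (h : n ≤ m) :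
    wCoeff (∑ i : Fin n, Finsupp.single (Fin.castLE h i) 1) (kernelSum n m k) =
      (((n.descFactorial k : MvPolynomial (Fin n) ℚ) *
        (∑ i : Fin n, MvPolynomial.X i) ^ (n - k) * MvPolynomial.esymm (Fin n) ℚ k :
          MvPolynomial (Fin n) ℚ) : MvPowerSeries (Fin n) ℚ) := by
  classical
  set S : Finset (Fin m) := Finset.univ.map (Fin.castLEEmb h) with hS
  have he : ∑ i : Fin n, Finsupp.single (Fin.castLE h i) 1 = indicatorExp S := by
    rw [indicatorExp, hS, Finset.sum_map]
    rfl
  have he1 : ∀ j, indicatorExp S j ≤ 1 := fun j => by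
    rw [indicatorExp_apply]
    split_ifs <;> simp
  rw [he]
  ext d
  change MvPowerSeries.coeff (Finsupp.sumElim d (indicatorExp S)) (kernelSum n m k) = _
  rw [coeff_eq_of_quotient_eq (quotient_kernelSum k he1), MvPolynomial.coeff_coe,
    MvPolynomial.coeff_coe]
  set p := ∑ i : Fin n, (MvPolynomial.X i : MvPolynomial (Fin n) ℚ)
  set q := MvPolynomial.esymm (Fin n) ℚ k
  have hexp : ((∏ j : Fin m, (1 + MvPolynomial.rename Sum.inl p * MvPolynomial.X (Sum.inr j))) *
        (MvPolynomial.rename Sum.inl q *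
          ∑ b : Fin k ↪ Fin m, ∏ r, MvPolynomial.X (Sum.inr (b r))) :
        MvPolynomial (Fin n ⊕ Fin m) ℚ) =
      ∑ b : Fin k ↪ Fin m, ∑ T : Finset (Fin m),
        MvPolynomial.rename Sum.inl (p ^ T.card * q) * MvPolynomial.rename Sum.inr
          (MvPolynomial.monomial (indicatorExp T + indicatorExp (Finset.univ.map b)) (1 : ℚ)) := by
    rw [Finset.prod_one_add, Finset.mul_sum, Finset.sum_mul_sum, Finset.sum_comm, Finset.powerset_univ]
    refine Finset.sum_congr rfl fun b _ => Finset.sum_congr rfl fun T _ => ?_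
    have h1 : MvPolynomial.monomial (indicatorExp T + indicatorExp (Finset.univ.map b)) (1 : ℚ) =
        (∏ j ∈ T, MvPolynomial.X j) * ∏ r, MvPolynomial.X (b r) := by
      rw [← Finset.prod_map Finset.univ b fun j => (MvPolynomial.X j : MvPolynomial (Fin m) ℚ),
        prod_X_eq_monomial, prod_X_eq_monomial, MvPolynomial.monomial_mul, one_mul]
    rw [h1, Finset.prod_mul_distrib, Finset.prod_const]
    simp only [map_mul, map_pow, map_prod, MvPolynomial.rename_X]
    ring
  have hd1 : (Finsupp.sumFinsuppEquivProdFinsupp (Finsupp.sumElim d (indicatorExp S))).1 = d := by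
    ext i
    simp
  have hd2 : (Finsupp.sumFinsuppEquivProdFinsupp (Finsupp.sumElim d (indicatorExp S))).2 =
      indicatorExp S := by
    ext j
    simp
  rw [hexp, MvPolynomial.coeff_sum]
  -- For a given `b`, the only surviving `T` is the complement in `S` of the image of `b`, of size
  -- `n - k`; there is none if the image leaves `S`.
  have hb : ∀ b : Fin k ↪ Fin m, MvPolynomial.coeff (Finsupp.sumElim d (indicatorExp S))
      (∑ T : Finset (Fin m),
        MvPolynomial.rename Sum.inl (p ^ T.card * q) * MvPolynomial.rename Sum.inr
          (MvPolynomial.monomial (indicatorExp T + indicatorExp (Finset.univ.map b)) (1 : ℚ))) =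
      if Finset.univ.map b ⊆ S then MvPolynomial.coeff d (p ^ (n - k) * q) else 0 := by
    intro b
    rw [MvPolynomial.coeff_sum]
    simp only [coeff_rename_mul_rename, hd1, hd2, MvPolynomial.coeff_monomial,
      indicatorExp_add_eq_iff, ite_and]
    split_ifs with hbS
    · rw [Finset.sum_eq_single (S \ Finset.univ.map b)]
      · rw [if_pos rfl, mul_one, Finset.card_sdiff_of_subset hbS, hS]
        simp
      · intro T _ hT
        rw [if_neg hT, mul_zero]
      · simp
    · simp
  rw [Finset.sum_congr rfl fun b _ => hb b, ← Finset.sum_filter, Finset.sum_const, card_emb_subset,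
    mul_assoc, ← nsmul_eq_mul, MvPolynomial.coeff_smul]
theorem lemma4p1 (n m k : ℕ) (hk : k ≤ n) :
    fallingCoeff (n - k) (agjSum n m (-Polynomial.X)) = (-1) ^ (n - k) * kernelSum n m k ∧
    ∀ h : n ≤ m,
      wCoeff (∑ i : Fin n, Finsupp.single (Fin.castLE h i) 1) (kernelSum n m k) =
        (((n.descFactorial k : MvPolynomial (Fin n) ℚ) *
          (∑ i : Fin n, MvPolynomial.X i) ^ (n - k) * MvPolynomial.esymm (Fin n) ℚ k :
            MvPolynomial (Fin n) ℚ) : MvPowerSeries (Fin n) ℚ) := by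
  exact ⟨fallingCoeff_agjSum n m k hk, fun h => wCoeff_kernelSum k h⟩
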